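/- Let $\mathbf k$ be a field of characteristic $0$. A nonsymmetric operad $\mathcal P=(\mathcal P,\circ,\mathbb 1)$ is a family $\{\mathcal P_n\}_{n\ge 1}$ of $\mathbf k$-vector spaces with bilinear maps $\circ_i:\mathcal P_m\times\mathcal P_n\to\mathcal P_{m+n-1}$ ($1\le i\le m$) and an element $\mathbb 1\in\mathcal P_1$ such that $f\circ_i(g\circ_j h)=(f\circ_i g)\circ_{i+j-1}h$ for $f\in\mathcal P_m$, $g\in\mathcal P_n$, $1\le i\le m$, $1\le j\le n$; $(f\circ_i g)\circ_{j+n-1}h=(f\circ_j h)\circ_i g$ for $1\le i<j\le m$; and $f\circ_i\mathbb 1=\mathbb 1\circ_1 f=f$. An element $\pi\in\mathcal P_2$ is a multiplication on $\mathcal P$ if $\pi\circ_1\pi=\pi\circ_2\pi$, and then $r\in\mathcal P_1$ is an averaging element for $\pi$ if $(\pi\circ_2 r)\circ_1 r=r\circ_1(\pi\circ_1 r)=r\circ_1(\pi\circ_2 r)$. For $n\ge1$ let $Y_n$ be the set of planar binary trees with $n+1$ leaves, labelled $0,\dots,n$ from left to right, and let $d_i:Y_n\to Y_{n-1}$ delete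 the $i$-th leaf. For $m,n\ge1$, $1\le i\le m$ and $T\in Y_{m+n-1}$ put $$R_0^{m;i,n}(T)=(d_i d_{i+1}\cdots d_{i+n-2})(T)\in Y_m,\qquad R_i^{m;i,n}(T)=(d_0\cdots d_{i-2}\,d_{i+n}\cdots d_{m+n-1})(T)\in Y_n .$$ Let $\mathcal Q_n=\mathrm{Hom}(\mathbf k[Y_n],\mathcal P_n)$ and, for $F\in\mathcal Q_m$, $G\in\mathcal Q_n$, $$(F\circ_i^{\mathcal Q}G)(T)=F(R_0^{m;i,n}(T))\circ_i G(R_i^{m;i,n}(T)),\qquad T\in Y_{m+n-1}.$$ For $x\in\mathcal P_n$ let $\widetilde x\in\mathcal Q_n$ be the map sending every tree of $Y_n$ to $x$, and write $\pi^{\mathcal Q}=\widetilde\pi$. Let $Y_2=\{T_r,T_l\}$, where in $T_r$ the leaves $1,2$, and in $T_l$ the leaves $0,1$, have a common parent. Define $\theta^{\mathcal Q}:\mathcal Q_m\to\mathcal Q_{m+1}$ by $$(\theta^{\mathcal Q}F)(T)=\begin{cases}(-1)^m(\pi^{\mathcal Q}\circ_2^{\mathcal Q}F)(T)&\text{if }R_0^{2;2,m}(T)=T_r,\\-(\pi^{\mathcal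 Q}\circ_1^{\mathcal Q}F)(T)&\text{if }R_0^{2;1,m}(T)=T_l,\\0&\text{otherwise}\end{cases}$$ (the first two cases exclude each other) and, for $F\in\mathcal Q_m$, $G\in\mathcal Q_n$, $$[\![F,G]\!]_{\mathsf D}=(\pi^{\mathcal Q}\circ_2^{\mathcal Q}G)\circ_1^{\mathcal Q}F-(-1)^{mn}(\pi^{\mathcal Q}\circ_2^{\mathcal Q}F)\circ_1^{\mathcal Q}G+\sum_{i=1}^n(-1)^{(i-1)m}\,G\circ_i^{\mathcal Q}\theta^{\mathcal Q}F-(-1)^{mn}\sum_{i=1}^m(-1)^{(i-1)n}\,F\circ_i^{\mathcal Q}\theta^{\mathcal Q}G\ \in\mathcal Q_{m+n}.$$ Let $\mathcal P$ be a nonsymmetric operad over $\mathbf k$ and $\pi\in\mathcal P_2$. Then: 1. $\mathcal Q=\{\mathcal Q_n\}_{n\ge1}$ with the partial compositions $\circ_i^{\mathcal Q}$ and the identity element $\widetilde{\mathbb 1}\in\mathcal Q_1$ is a nonsymmetric operad. 2. $\pi$ is a multiplication on $\mathcal P$ if and only if $\pi^{\mathcal Q}$ is a multiplication on $\mathcal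 Q$. 3. If $\pi$ is a multiplication on $\mathcal P$, then $(\mathcal Q_\bullet=\bigoplus_{n\ge1}\mathcal Q_n,[\![\ ,\ ]\!]_{\mathsf D})$, with $\mathcal Q_n$ in degree $n$, is a graded Lie algebra: the bracket is bilinear, graded skew-symmetric and satisfies the graded Jacobi identity. 4. If $\pi$ is a multiplication on $\mathcal P$, then $r\in\mathcal P_1$ is an averaging element for $\pi$ if and only if $\widetilde r\in\mathcal Q_1$ is a Maurer–Cartan element, i.e. $[\![\widetilde r,\widetilde r]\!]_{\mathsf D}=0$; moreover, every Maurer–Cartan element of $(\mathcal Q_\bullet,[\![\ ,\ ]\!]_{\mathsf D})$ is of the form $\widetilde r$ for an averaging element $r$. -/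

import Mathlib

namespace AveragingOperad

universe u v

/-! ### Nonsymmetric operads

The spaces of a nonsymmetric operad are a family `P : ℕ → Type v`, where `P n` is the space of
operations of arity `n`. Only the arities `n ≥ 1` are used: no axiom and no construction below
says anything about `P 0`. -/

/-- `Composable m n l i` says that `∘ᵢ : P m × P n → P l` is one of the partial compositions of an
operad: `m, n ≥ 1`, `1 ≤ i ≤ m` and `l = m + n - 1`. -/
abbrev Composable (m n l i : ℕ) : Prop :=
  1 ≤ i ∧ i ≤ m ∧ 1 ≤ n ∧ m + n = l + 1

/-- The data of a nonsymmetric operad: partial compositions and an element of arity one. The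
target arity `l` is a variable tied to `m + n - 1` by a proof, which spares all transports along
equalities of arities. -/
structure OperadData (P : ℕ → Type v) where
  /-- The partial composition `f ∘ᵢ g`, for `f` of arity `m` and `g` of arity `n`. -/
  comp : ∀ {m n l : ℕ} (i : ℕ), Composable m n l i → P m → P n → P l
  /-- The identity element. -/
  one : P 1

/-- The axioms of a nonsymmetric operad: the partial compositions are bilinear, satisfy the
sequential and the parallel associativity law, and have a two-sided identity. -/
structure IsNSOperad (k : Type u) [Field k] {P : ℕ → Type v} [∀ n, AddCommGroup (P n)]
    [∀ n, Module k (P n)] (O : OperadData P) : Prop where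
  add_comp : ∀ {m n l i : ℕ} (h : Composable m n l i) (f f' : P m) (g : P n),
    O.comp i h (f + f') g = O.comp i h f g + O.comp i h f' g
  smul_comp : ∀ {m n l i : ℕ} (h : Composable m n l i) (c : k) (f : P m) (g : P n),
    O.comp i h (c • f) g = c • O.comp i h f g
  comp_add : ∀ {m n l i : ℕ} (h : Composable m n l i) (f : P m) (g g' : P n),
    O.comp i h f (g + g') = O.comp i h f g + O.comp i h f g'
  comp_smul : ∀ {m n l i : ℕ} (h : Composable m n l i) (c : k) (f : P m) (g : P n),
    O.comp i h f (c • g) = c • O.comp i h f g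
  /-- `f ∘ᵢ (g ∘ⱼ h) = (f ∘ᵢ g) ∘ᵢ₊ⱼ₋₁ h` -/
  comp_seq : ∀ {m n p a b l i j : ℕ} (hgh : Composable n p a j) (hf : Composable m a l i)
    (hfg : Composable m n b i) (hh : Composable b p l (i + j - 1))
    (f : P m) (g : P n) (h : P p),
    O.comp i hf f (O.comp j hgh g h) = O.comp (i + j - 1) hh (O.comp i hfg f g) h
  /-- `(f ∘ᵢ g) ∘ⱼ₊ₙ₋₁ h = (f ∘ⱼ h) ∘ᵢ g` for `i < j` -/
  comp_par : ∀ {m n p a b l i j : ℕ} (_ : i < j)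
    (hfg : Composable m n a i) (hh : Composable a p l (j + n - 1))
    (hfh : Composable m p b j) (hg : Composable b n l i)
    (f : P m) (g : P n) (h : P p),
    O.comp (j + n - 1) hh (O.comp i hfg f g) h = O.comp i hg (O.comp j hfh f h) g
  comp_one : ∀ {m i : ℕ} (h : Composable m 1 m i) (f : P m), O.comp i h f O.one = f
  one_comp : ∀ {m : ℕ} (h : Composable 1 m m 1) (f : P m), O.comp 1 h O.one f = f

section Operations

variable {P : ℕ → Type v} (O : OperadData P)

/-- `π` is a multiplication: `π ∘₁ π = π ∘₂ π`. -/
def IsMultiplication (π : P 2) : Prop :=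
  O.comp (l := 3) 1 (by omega) π π = O.comp (l := 3) 2 (by omega) π π

/-- `r` is an averaging element for `π`:
`(π ∘₂ r) ∘₁ r = r ∘₁ (π ∘₁ r) = r ∘₁ (π ∘₂ r)`. -/
def IsAveragingElement (π : P 2) (r : P 1) : Prop :=
  O.comp (l := 2) 1 (by omega) (O.comp (l := 2) 2 (by omega) π r) r =
      O.comp (l := 2) 1 (by omega) r (O.comp (l := 2) 1 (by omega) π r) ∧
    O.comp (l := 2) 1 (by omega) r (O.comp (l := 2) 1 (by omega) π r) =
      O.comp (l := 2) 1 (by omega) r (O.comp (l := 2) 2 (by omega) π r)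

/-- The cup product `f ∪ g = (π ∘₂ g) ∘₁ f`. -/
def cup (π : P 2) {m n l : ℕ} (hm : 1 ≤ m) (hn : 1 ≤ n) (h : m + n = l) (f : P m) (g : P n) :
    P l :=
  O.comp (l := l) 1 (by omega) (O.comp (l := n + 1) 2 (by omega) π g) f

variable [∀ n, AddCommGroup (P n)]

/-- The contraction `ι_g f = ∑_{i=1}^{m} (-1)^{(i-1)(n-1)} f ∘ᵢ g`; the summation index below is
`i - 1`. -/
def contraction {m n l : ℕ} (hn : 1 ≤ n) (h : m + n = l + 1) (g : P n) (f : P m) : P l :=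
  ∑ i : Fin m, (-1 : ℤ) ^ ((i : ℕ) * (n - 1)) •
    O.comp (l := l) ((i : ℕ) + 1) (by omega) f g

/-- The cup bracket `[f, g]_π = f ∪ g - (-1)^{mn} g ∪ f`. -/
def cupBracket (π : P 2) {m n l : ℕ} (hm : 1 ≤ m) (hn : 1 ≤ n) (h : m + n = l)
    (f : P m) (g : P n) : P l :=
  cup O π hm hn h f g - (-1 : ℤ) ^ (m * n) • cup O π hn hm (by omega) g f

end Operations

/-! ### Planar binary trees -/

/-- `PBT n` is the set `Y_n` of planar binary trees with `n` interior vertices, equivalently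
`n + 1` leaves. -/
abbrev PBT (n : ℕ) : Type := {t : BinaryTree Unit // t.numNodes = n}

/-- Delete the `i`-th leaf, the leaves being labelled `0, 1, 2, …` from left to right: the parent
of the leaf disappears and the sibling subtree takes its place. -/
def deleteLeaf : BinaryTree Unit → ℕ → BinaryTree Unit
  | .nil, _ => .nil
  | .node _ a b, i =>
    if i < a.numLeaves then
      if a = .nil then b else .node () (deleteLeaf a i) b
    else
      if b = .nil then a else .node () a (deleteLeaf b (i - a.numLeaves))

theorem numNodes_deleteLeaf (t : BinaryTree Unit) (i : ℕ) :
    (deleteLeaf t i).numNodes = t.numNodes - 1 := by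
  induction t generalizing i with
  | nil => rfl
  | node x a b iha ihb =>
    have pos : ∀ c : BinaryTree Unit, c ≠ .nil → 1 ≤ c.numNodes := by
      intro c hc
      cases c with
      | nil => exact absurd rfl hc
      | node => simp [BinaryTree.numNodes]
    rw [deleteLeaf]
    split_ifs with h1 h2 h3
    · subst h2; simp [BinaryTree.numNodes]
    · have := pos a h2
      simp only [BinaryTree.numNodes, iha]; omega
    · subst h3; simp [BinaryTree.numNodes]
    · have := pos b h3
      simp only [BinaryTree.numNodes, ihb]; omega

/-- `deleteLeaves t i c = (d_i d_{i+1} ⋯ d_{i+c-1}) t`, where `d_j` deletes the `j`-th leaf. -/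
def deleteLeaves (t : BinaryTree Unit) (i : ℕ) : ℕ → BinaryTree Unit
  | 0 => t
  | c + 1 => deleteLeaves (deleteLeaf t (i + c)) i c

theorem numNodes_deleteLeaves (t : BinaryTree Unit) (i c : ℕ) :
    (deleteLeaves t i c).numNodes = t.numNodes - c := by
  induction c generalizing t with
  | zero => rfl
  | succ c ih => rw [deleteLeaves, ih, numNodes_deleteLeaf]; omega

/-- `R_0^{m;i,n} = d_i d_{i+1} ⋯ d_{i+n-2} : Y_{m+n-1} → Y_m`. -/
def outerTree {m n l i : ℕ} (h : Composable m n l i) (T : PBT l) : PBT m :=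
  ⟨deleteLeaves T.1 i (n - 1), by rw [numNodes_deleteLeaves, T.2]; omega⟩

/-- `R_i^{m;i,n} = d_0 ⋯ d_{i-2} d_{i+n} ⋯ d_{m+n-1} : Y_{m+n-1} → Y_n`. -/
def innerTree {m n l i : ℕ} (h : Composable m n l i) (T : PBT l) : PBT n :=
  ⟨deleteLeaves (deleteLeaves T.1 (i + n) (m - i)) 0 (i - 1), by
    rw [numNodes_deleteLeaves, numNodes_deleteLeaves, T.2]; omega⟩

/-- The tree of `Y_2` whose leaves `1` and `2` have a common parent. -/
def rightTree : PBT 2 := ⟨.node () .nil (.node () .nil .nil), rfl⟩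

/-- The tree of `Y_2` whose leaves `0` and `1` have a common parent. -/
def leftTree : PBT 2 := ⟨.node () (.node () .nil .nil) .nil, rfl⟩

/-! ### The operad of tree-indexed operations -/

section Trees

variable (k : Type u) [Field k] {P : ℕ → Type v} [∀ n, AddCommGroup (P n)] [∀ n, Module k (P n)]

/-- `Q_n = Hom(k[Y_n], P_n)`. -/
abbrev TreeHom (P : ℕ → Type v) [∀ n, AddCommGroup (P n)] [∀ n, Module k (P n)] (n : ℕ) :
    Type (max u v) :=
  (PBT n →₀ k) →ₗ[k] P n

variable {k} in
/-- The value of `F` on a tree. -/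
noncomputable def TreeHom.val {n : ℕ} (F : TreeHom k P n) (T : PBT n) : P n :=
  F (Finsupp.single T 1)

/-- The linear map on `k[Y_n]` with prescribed values on trees. -/
noncomputable def TreeHom.mk {n : ℕ} (φ : PBT n → P n) : TreeHom k P n :=
  Finsupp.lift (P n) k (PBT n) φ

/-- The linear map on `k[Y_n]` that sends every tree to `x`. -/
noncomputable def TreeHom.const {n : ℕ} (x : P n) : TreeHom k P n :=
  TreeHom.mk k fun _ => x

/-- The partial compositions
`(F ∘ᵢ G)(T) = F (R_0^{m;i,n} T) ∘ᵢ G (R_i^{m;i,n} T)` on the spaces `Q_n`, and the element of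
`Q_1` that sends the only tree of `Y_1` to the identity of `P`. -/
noncomputable def treeOperad (O : OperadData P) : OperadData (TreeHom k P) where
  comp i h F G := TreeHom.mk k fun T => O.comp i h (F.val (outerTree h T)) (G.val (innerTree h T))
  one := TreeHom.const k O.one

variable (O : OperadData P) (π : P 2)

/-- The map `θ : Q_m → Q_{m+1}`. The two conditions on `T` say that its left, respectively right,
branch at the root is a single leaf; they exclude each other, and `θ F` vanishes on the trees
that satisfy neither. -/
noncomputable def treeTheta {m : ℕ} (hm : 1 ≤ m) (F : TreeHom k P m) : TreeHom k P (m + 1) :=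
  TreeHom.mk k fun T =>
    if outerTree (m := 2) (n := m) (i := 2) (by omega) T = rightTree then
      (-1 : ℤ) ^ m •
        ((treeOperad k O).comp (l := m + 1) 2 (by omega) (TreeHom.const k π) F).val T
    else if outerTree (m := 2) (n := m) (i := 1) (by omega) T = leftTree then
      -((treeOperad k O).comp (l := m + 1) 1 (by omega) (TreeHom.const k π) F).val T
    else 0

/-- The derived bracket
`⟦F, G⟧ = [F, G]_π + ι_{θF} G - (-1)^{mn} ι_{θG} F : Q_m × Q_n → Q_{m+n}`. -/
noncomputable def treeDerivedBracket {m n l : ℕ} (hm : 1 ≤ m) (hn : 1 ≤ n) (h : m + n = l)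
    (F : TreeHom k P m) (G : TreeHom k P n) : TreeHom k P l :=
  cupBracket (treeOperad k O) (TreeHom.const k π) hm hn h F G
    + contraction (treeOperad k O) (by omega) (by omega) (treeTheta k O π hm F) G
    - (-1 : ℤ) ^ (m * n) •
      contraction (treeOperad k O) (by omega) (by omega) (treeTheta k O π hn G) F

end Trees

/-! ### Graded Lie algebras -/

/-- A bracket `L_m × L_n → L_{m+n}`, for `m, n ≥ 1`, on a graded vector space concentrated in
positive degrees. -/
abbrev GradedBracket (L : ℕ → Type v) : Type v :=
  ∀ {m n l : ℕ}, 1 ≤ m → 1 ≤ n → m + n = l → L m → L n → L l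

/-- `br` makes `⨁_{n ≥ 1} L n` a graded Lie algebra (over a field of characteristic `0`): it is
bilinear, graded skew-symmetric, and satisfies the graded Jacobi identity. -/
structure IsGradedLieBracket (k : Type u) [Field k] {L : ℕ → Type v} [∀ n, AddCommGroup (L n)]
    [∀ n, Module k (L n)] (br : GradedBracket L) : Prop where
  add_left : ∀ {m n l : ℕ} (hm : 1 ≤ m) (hn : 1 ≤ n) (h : m + n = l) (x x' : L m) (y : L n),
    br hm hn h (x + x') y = br hm hn h x y + br hm hn h x' y
  smul_left : ∀ {m n l : ℕ} (hm : 1 ≤ m) (hn : 1 ≤ n) (h : m + n = l) (c : k) (x : L m) (y : L n),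
    br hm hn h (c • x) y = c • br hm hn h x y
  add_right : ∀ {m n l : ℕ} (hm : 1 ≤ m) (hn : 1 ≤ n) (h : m + n = l) (x : L m) (y y' : L n),
    br hm hn h x (y + y') = br hm hn h x y + br hm hn h x y'
  smul_right : ∀ {m n l : ℕ} (hm : 1 ≤ m) (hn : 1 ≤ n) (h : m + n = l) (c : k) (x : L m)
    (y : L n), br hm hn h x (c • y) = c • br hm hn h x y
  skew : ∀ {m n l : ℕ} (hm : 1 ≤ m) (hn : 1 ≤ n) (h : m + n = l) (x : L m) (y : L n),
    br hm hn h x y = -((-1 : ℤ) ^ (m * n) • br hn hm (by omega) y x)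
  /-- `[x, [y, z]] = [[x, y], z] + (-1)^{mn} [y, [x, z]]` -/
  jacobi : ∀ {m n p l : ℕ} (hm : 1 ≤ m) (hn : 1 ≤ n) (hp : 1 ≤ p) (h : m + n + p = l)
    (x : L m) (y : L n) (z : L p),
    br (n := n + p) hm (by omega) (by omega) x (br hn hp rfl y z) =
      br (m := m + n) (l := l) (by omega) hp h (br hm hn rfl x y) z +
        (-1 : ℤ) ^ (m * n) • br (n := m + p) hn (by omega) (by omega) y (br hm hp rfl x z)

/-- A Maurer–Cartan element of a graded Lie algebra: an element `x` of degree `1` with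
`[x, x] = 0`. -/
def IsMaurerCartan {L : ℕ → Type v} [∀ n, AddCommGroup (L n)] (br : GradedBracket L) (x : L 1) :
    Prop :=
  br (l := 2) le_rfl le_rfl rfl x x = 0

end AveragingOperad

namespace AveragingOperad

universe u v

/-! ### Deleting leaves -/

/-! The operad laws for `treeOperad` reduce to those of `O`, because for each composite the two
sides evaluate the factors on trees obtained from `T` by keeping the same leaves. All this rests on
the face relation `deleteLeaf_comm` and its versions for blocks of leaves. For the bracket, three
structures interact. The cup product is associative when `π` is a multiplication, so its graded
commutator is a Lie bracket. The Gerstenhaber bracket acts through the contractions ι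
(`IsNSOperad.insertion_commutator`), and each contraction is a graded derivation of the cup product
(`IsNSOperad.insertion_cupProd`). Finally θ carries ⟦F, G⟧ = [F, G]_π + ι_{θF} G ∓ ι_{θG} F to the
Gerstenhaber bracket of θF and θG (`treeTheta_treeDerivedBracket`). Given these facts, the graded
Jacobi identity is a cancellation of terms. That θ respects brackets is checked tree by tree. The
value of θF at `T` depends on `leftLeaves T`, the size of the left branch at the root: 1 and the
maximum give ±π ∘₂ F and -π ∘₁ F, anything else gives 0. At the two extremes associativity of `π`
produces the cup terms; in between only two insertions survive, and they cancel in the commutator.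
In degree 1 every element is constant since `Y_1` is a single tree. The two trees of `Y_2` turn ⟦r,
r⟧ = 0 into the two averaging equations, up to a factor 2. -/

theorem numLeaves_pos (t : BinaryTree Unit) : 1 ≤ t.numLeaves := by
  rw [BinaryTree.numLeaves_eq_numNodes_succ]; omega

theorem eq_nil_of_numLeaves {t : BinaryTree Unit} (h : t.numLeaves = 1) : t = .nil := by
  rw [BinaryTree.numLeaves_eq_numNodes_succ] at h
  cases t with
  | nil => rfl
  | node => simp [BinaryTree.numNodes] at h

theorem eq_nil_iff_numLeaves {t : BinaryTree Unit} : t = .nil ↔ t.numLeaves = 1 :=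
  ⟨fun h => by subst h; rfl, eq_nil_of_numLeaves⟩

theorem numLeaves_deleteLeaf (t : BinaryTree Unit) (i : ℕ) :
    (deleteLeaf t i).numLeaves = t.numLeaves - 1 - 1 + 1 := by
  simp only [BinaryTree.numLeaves_eq_numNodes_succ, numNodes_deleteLeaf]; omega

theorem numLeaves_deleteLeaves (t : BinaryTree Unit) (i c : ℕ) :
    (deleteLeaves t i c).numLeaves = t.numLeaves - 1 - c + 1 := by
  simp only [BinaryTree.numLeaves_eq_numNodes_succ, numNodes_deleteLeaves]; omega

theorem deleteLeaf_node (a b : BinaryTree Unit) (i : ℕ) :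
    deleteLeaf (.node () a b) i =
      if i < a.numLeaves then
        if a.numLeaves = 1 then b else .node () (deleteLeaf a i) b
      else
        if b.numLeaves = 1 then a else .node () a (deleteLeaf b (i - a.numLeaves)) := by
  simp only [← eq_nil_iff_numLeaves, deleteLeaf]

/-- The simplicial relation d_i d_j = d_{j-1} d_i for i < j. Leaves in different branches at the
root do not interact, except that a branch which is a single leaf vanishes together with the root;
leaves in the same branch are handled by induction. -/
theorem deleteLeaf_comm (t : BinaryTree Unit) {i j : ℕ} (hij : i < j) (hj : j < t.numLeaves) :
    deleteLeaf (deleteLeaf t j) i = deleteLeaf (deleteLeaf t i) (j - 1) := by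
  induction t generalizing i j with
  | nil => rfl
  | node x a b iha ihb =>
    have hA := numLeaves_pos a
    have hB := numLeaves_pos b
    simp only [BinaryTree.numLeaves] at hj
    have e : ∀ k, deleteLeaf (.node x a b) k = deleteLeaf (.node () a b) k := fun _ => rfl
    simp only [e, deleteLeaf_node]
    rcases lt_or_ge j a.numLeaves with h1 | h1
    · have h2 : i < a.numLeaves := by omega
      have h3 : a.numLeaves ≠ 1 := by omega
      simp only [h1, h2, h3, if_true, if_false, deleteLeaf_node, numLeaves_deleteLeaf]
      rw [if_pos (show i < a.numLeaves - 1 - 1 + 1 by omega),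
        if_pos (show j - 1 < a.numLeaves - 1 - 1 + 1 by omega), iha hij h1]
    · have h1' : ¬ j < a.numLeaves := by omega
      simp only [h1', if_false]
      rcases lt_or_ge i a.numLeaves with h2 | h2
      · simp only [h2, if_true]
        by_cases hb : b.numLeaves = 1
        · by_cases ha : a.numLeaves = 1
          · rw [if_pos hb, if_pos ha, eq_nil_of_numLeaves ha, eq_nil_of_numLeaves hb]; rfl
          · simp only [hb, ha, if_true, if_false, deleteLeaf_node, numLeaves_deleteLeaf]
            rw [if_neg (by omega)]
        · by_cases ha : a.numLeaves = 1
          · simp only [hb, ha, if_true, if_false, deleteLeaf_node]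
            rw [if_pos (by omega)]
          · simp only [hb, ha, if_false, deleteLeaf_node, numLeaves_deleteLeaf]
            rw [if_pos (by omega), if_neg (by omega)]
            congr 2; omega
      · have h2' : ¬ i < a.numLeaves := by omega
        have hb : b.numLeaves ≠ 1 := by omega
        simp only [h2', hb, if_false, deleteLeaf_node, numLeaves_deleteLeaf]
        rw [if_neg (show ¬ j - 1 < a.numLeaves by omega), ihb (i := i - a.numLeaves) (j := j - a.numLeaves) (by omega)
          (by omega), show j - a.numLeaves - 1 = j - 1 - a.numLeaves by omega]

theorem deleteLeaf_deleteLeaves_left (t : BinaryTree Unit) {i j c : ℕ} (hij : i < j)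
    (hj : j + c ≤ t.numLeaves) :
    deleteLeaf (deleteLeaves t j c) i = deleteLeaves (deleteLeaf t i) (j - 1) c := by
  induction c generalizing t with
  | zero => rfl
  | succ c ih =>
    rw [deleteLeaves, deleteLeaves, ih _ (by rw [numLeaves_deleteLeaf]; omega),
      deleteLeaf_comm t (by omega) (by omega), show j - 1 + c = j + c - 1 by omega]

/-- Deletions of disjoint blocks of leaves commute. -/
theorem deleteLeaves_comm (t : BinaryTree Unit) {i j c e : ℕ} (hij : i + c ≤ j)
    (hj : j + e ≤ t.numLeaves) :
    deleteLeaves (deleteLeaves t j e) i c = deleteLeaves (deleteLeaves t i c) (j - c) e := by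
  induction c generalizing t j with
  | zero => rfl
  | succ c ih =>
    rw [deleteLeaves, deleteLeaves, deleteLeaf_deleteLeaves_left t (by omega) hj,
      ih _ (by omega) (by rw [numLeaves_deleteLeaf]; omega), show j - 1 - c = j - (c + 1) by omega]

theorem deleteLeaves_add (t : BinaryTree Unit) (i c e : ℕ) :
    deleteLeaves t i (c + e) = deleteLeaves (deleteLeaves t (i + c) e) i c := by
  induction e generalizing t with
  | zero => rfl
  | succ e ih => rw [← add_assoc, deleteLeaves, deleteLeaves, ih, add_assoc]

/-- Deleting a block of leaves, then a block around its position, deletes one larger block. -/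
theorem deleteLeaves_deleteLeaves (t : BinaryTree Unit) {i j c e : ℕ} (hij : i ≤ j)
    (hji : j ≤ i + e) (h : i + e + c ≤ t.numLeaves) :
    deleteLeaves (deleteLeaves t j c) i e = deleteLeaves t i (e + c) := by
  obtain ⟨d, rfl⟩ := Nat.exists_eq_add_of_le hij
  obtain ⟨e', rfl⟩ := Nat.exists_eq_add_of_le (show d ≤ e by omega)
  -- Here d leaves of the outer block precede position j and e' follow it. After the inner block is
  -- gone, those e' leaves have moved into its place; commuting the two deletions puts them back
  -- next to it.
  rw [deleteLeaves_add _ _ d e', show d + e' + c = d + (c + e') by omega,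
    deleteLeaves_add t i d, deleteLeaves_add t (i + d) c,
    deleteLeaves_comm t (i := i + d) (j := i + d + c) le_rfl (by omega), Nat.add_sub_cancel]

/-- The number of leaves of the left branch at the root. -/
def leftLeaves (t : BinaryTree Unit) : ℕ := t.left.numLeaves

theorem leftLeaves_bounds {t : BinaryTree Unit} (h : 2 ≤ t.numLeaves) :
    1 ≤ leftLeaves t ∧ leftLeaves t + 1 ≤ t.numLeaves := by
  cases t with
  | nil => simp [BinaryTree.numLeaves] at h
  | node x a b =>
    have := numLeaves_pos a
    have := numLeaves_pos b
    simp only [leftLeaves, BinaryTree.left, BinaryTree.numLeaves]; omega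

/-- A left branch with at least two leaves outlives the deletion, so the root stays the root. -/
theorem leftLeaves_deleteLeaf_of_lt {t : BinaryTree Unit} {i : ℕ} (hi : i < leftLeaves t)
    (h : 2 ≤ leftLeaves t) : leftLeaves (deleteLeaf t i) = leftLeaves t - 1 := by
  cases t with
  | nil => simp [leftLeaves, BinaryTree.left, BinaryTree.numLeaves] at h
  | node x a b =>
    simp only [leftLeaves, BinaryTree.left] at hi h ⊢
    change (deleteLeaf (.node () a b) i).left.numLeaves = _
    rw [deleteLeaf_node, if_pos hi, if_neg (by omega)]
    simp only [BinaryTree.left, numLeaves_deleteLeaf]; omega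

theorem leftLeaves_deleteLeaf_of_le {t : BinaryTree Unit} {i : ℕ} (hi : leftLeaves t ≤ i)
    (h : leftLeaves t + 2 ≤ t.numLeaves) : leftLeaves (deleteLeaf t i) = leftLeaves t := by
  cases t with
  | nil => simp [leftLeaves, BinaryTree.left, BinaryTree.numLeaves] at h
  | node x a b =>
    simp only [leftLeaves, BinaryTree.left, BinaryTree.numLeaves] at hi h ⊢
    change (deleteLeaf (.node () a b) i).left.numLeaves = _
    rw [deleteLeaf_node, if_neg (by omega), if_neg (by omega)]
    simp only [BinaryTree.left]

/-- Deleting the leaves `i, …, i + c - 1` deletes those of them that belong to the left branch,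
provided that neither branch loses all its leaves. -/
theorem leftLeaves_deleteLeaves {t : BinaryTree Unit} {i c x : ℕ} (hi : i + c ≤ t.numLeaves)
    (hx : x + min (i + c) (leftLeaves t) = leftLeaves t + min i (leftLeaves t))
    (h1 : 1 ≤ x) (h2 : x + 1 + c ≤ t.numLeaves) :
    leftLeaves (deleteLeaves t i c) = x := by
  induction c generalizing t with
  | zero => rw [deleteLeaves]; omega
  | succ c ih =>
    rw [deleteLeaves]
    -- The last leaf of the block goes first. `h1` and `h2` leave each branch a leaf at the end, so
    -- no branch is exhausted on the way. `hx` is written additively to avoid truncated subtraction.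
    rcases lt_or_ge (i + c) (leftLeaves t) with h | h
    · have e := leftLeaves_deleteLeaf_of_lt h (by omega)
      have e' := numLeaves_deleteLeaf t (i + c)
      apply ih <;> omega
    · have e := leftLeaves_deleteLeaf_of_le h (by omega)
      have e' := numLeaves_deleteLeaf t (i + c)
      apply ih <;> omega

theorem PBT.numLeaves {n : ℕ} (T : PBT n) : T.1.numLeaves = n + 1 := by
  rw [BinaryTree.numLeaves_eq_numNodes_succ, T.2]

/-- Together with `PBT.eq_leftTree_iff`, this turns the case distinction in θ into arithmetic. -/
theorem PBT.eq_rightTree_iff (T : PBT 2) : T = rightTree ↔ leftLeaves T.1 = 1 := by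
  constructor
  · rintro rfl; rfl
  · rcases T with ⟨_ | ⟨x, a, b⟩, h⟩
    · simp at h
    intro hl
    have ha : a = .nil := eq_nil_of_numLeaves hl
    subst ha
    rcases b with _ | ⟨y, b, c⟩
    · simp [BinaryTree.numNodes] at h
    · simp only [BinaryTree.numNodes] at h
      have hb : b = .nil := eq_nil_of_numLeaves (by
        rw [BinaryTree.numLeaves_eq_numNodes_succ]; omega)
      have hc : c = .nil := eq_nil_of_numLeaves (by
        rw [BinaryTree.numLeaves_eq_numNodes_succ]; omega)
      subst hb hc; rfl

theorem PBT.eq_leftTree_iff (T : PBT 2) : T = leftTree ↔ leftLeaves T.1 = 2 := by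
  constructor
  · rintro rfl; rfl
  · rcases T with ⟨_ | ⟨x, a, b⟩, h⟩
    · simp at h
    intro hl
    rcases a with _ | ⟨y, a, c⟩
    · simp [leftLeaves, BinaryTree.left, BinaryTree.numLeaves] at hl
    · simp only [leftLeaves, BinaryTree.left, BinaryTree.numLeaves_eq_numNodes_succ,
        BinaryTree.numNodes] at h hl
      have ha : a = .nil := eq_nil_of_numLeaves (by
        rw [BinaryTree.numLeaves_eq_numNodes_succ]; omega)
      have hc : c = .nil := eq_nil_of_numLeaves (by
        rw [BinaryTree.numLeaves_eq_numNodes_succ]; omega)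
      have hb : b = .nil := eq_nil_of_numLeaves (by
        rw [BinaryTree.numLeaves_eq_numNodes_succ]; omega)
      subst ha hb hc; rfl

theorem PBT.eq_of_one (S T : PBT 1) : S = T := by
  have key : ∀ T : PBT 1, T.1 = .node () .nil .nil := by
    rintro ⟨_ | ⟨x, a, b⟩, h⟩
    · simp at h
    · simp only [BinaryTree.numNodes] at h
      have ha : a = .nil := eq_nil_of_numLeaves (by
        rw [BinaryTree.numLeaves_eq_numNodes_succ]; omega)
      have hb : b = .nil := eq_nil_of_numLeaves (by
        rw [BinaryTree.numLeaves_eq_numNodes_succ]; omega)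
      subst ha hb; rfl
  exact Subtype.ext ((key S).trans (key T).symm)

/-! ### The operad of tree-indexed operations -/

section TreeOperad

variable {k : Type u} [Field k] {P : ℕ → Type v} [∀ n, AddCommGroup (P n)] [∀ n, Module k (P n)]

@[simp]
theorem TreeHom.val_mk {n : ℕ} (φ : PBT n → P n) (T : PBT n) : (TreeHom.mk k φ).val T = φ T := by
  simp [TreeHom.val, TreeHom.mk]

@[simp]
theorem TreeHom.val_const {n : ℕ} (x : P n) (T : PBT n) : (TreeHom.const k x).val T = x :=
  TreeHom.val_mk _ T

theorem TreeHom.ext_val {n : ℕ} {F G : TreeHom k P n} (h : ∀ T, F.val T = G.val T) : F = G :=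
  Finsupp.lhom_ext' fun T => LinearMap.ext_ring (h T)

@[simp]
theorem TreeHom.val_add {n : ℕ} (F G : TreeHom k P n) (T : PBT n) :
    (F + G).val T = F.val T + G.val T := rfl

@[simp]
theorem TreeHom.val_sub {n : ℕ} (F G : TreeHom k P n) (T : PBT n) :
    (F - G).val T = F.val T - G.val T := rfl

@[simp]
theorem TreeHom.val_neg {n : ℕ} (F : TreeHom k P n) (T : PBT n) : (-F).val T = -F.val T := rfl

@[simp]
theorem TreeHom.val_zero {n : ℕ} (T : PBT n) : (0 : TreeHom k P n).val T = 0 := rfl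

@[simp]
theorem TreeHom.val_smul {n : ℕ} (c : k) (F : TreeHom k P n) (T : PBT n) :
    (c • F).val T = c • F.val T := rfl

@[simp]
theorem TreeHom.val_zsmul {n : ℕ} (c : ℤ) (F : TreeHom k P n) (T : PBT n) :
    (c • F).val T = c • F.val T := rfl

theorem TreeHom.val_sum {n : ℕ} {ι : Type*} (s : Finset ι) (F : ι → TreeHom k P n) (T : PBT n) :
    (∑ i ∈ s, F i).val T = ∑ i ∈ s, (F i).val T :=
  LinearMap.sum_apply s F _

@[simp]
theorem treeOperad_comp_val (O : OperadData P) {m n l i : ℕ} (h : Composable m n l i)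
    (F : TreeHom k P m) (G : TreeHom k P n) (T : PBT l) :
    ((treeOperad k O).comp i h F G).val T =
      O.comp i h (F.val (outerTree h T)) (G.val (innerTree h T)) :=
  TreeHom.val_mk _ T

/-! ### Outer and inner trees of iterated compositions -/

section Trees

variable {m n p a b l i j : ℕ}

/-- In this and the next five identities both sides keep the same leaves of `T`: an outer tree drops
the leaves i, …, i + n - 2, an inner tree keeps i - 1, …, i + n - 1. Disjoint blocks are reordered
by `deleteLeaves_comm`, nested ones merged by `deleteLeaves_deleteLeaves`. -/
theorem outerTree_outerTree_seq (hgh : Composable n p a j) (hf : Composable m a l i)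
    (hfg : Composable m n b i) (hh : Composable b p l (i + j - 1)) (T : PBT l) :
    outerTree hfg (outerTree hh T) = outerTree hf T := by
  have hT := T.numLeaves
  apply Subtype.ext
  simp only [outerTree]
  rw [deleteLeaves_deleteLeaves _ (by omega) (by omega) (by omega)]
  congr 1; omega

theorem outerTree_innerTree_seq (hgh : Composable n p a j) (hf : Composable m a l i)
    (hfg : Composable m n b i) (hh : Composable b p l (i + j - 1)) (T : PBT l) :
    innerTree hfg (outerTree hh T) = outerTree hgh (innerTree hf T) := by
  have hT := T.numLeaves
  apply Subtype.ext
  simp only [outerTree, innerTree]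
  have e := deleteLeaves_comm T.1 (i := i + j - 1) (c := p - 1) (j := i + a) (e := m - i)
    (by omega) (by omega)
  rw [show i + a - (p - 1) = i + n by omega] at e
  rw [← e, deleteLeaves_comm _ (i := 0) (c := i - 1) (j := i + j - 1) (e := p - 1) (by omega)
    (by rw [numLeaves_deleteLeaves]; omega)]
  congr 1; omega

theorem innerTree_innerTree_seq (hgh : Composable n p a j) (hf : Composable m a l i)
    (hh : Composable b p l (i + j - 1)) (T : PBT l) :
    innerTree hgh (innerTree hf T) = innerTree hh T := by
  have hT := T.numLeaves
  apply Subtype.ext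
  simp only [innerTree]
  have e := deleteLeaves_comm (deleteLeaves T.1 (i + a) (m - i)) (i := 0) (c := i - 1)
    (j := i + j - 1 + p) (e := n - j) (by omega) (by rw [numLeaves_deleteLeaves]; omega)
  rw [show i + j - 1 + p - (i - 1) = j + p by omega] at e
  rw [← e, deleteLeaves_deleteLeaves T.1 (by omega) (by omega) (by omega),
    deleteLeaves_deleteLeaves _ (i := 0) (j := 0) (by omega) (by omega)
      (by rw [numLeaves_deleteLeaves]; omega)]
  congr 1
  · congr 1; omega
  · omega

theorem outerTree_outerTree_par (hij : i < j) (hfg : Composable m n a i)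
    (hh : Composable a p l (j + n - 1)) (hfh : Composable m p b j) (hg : Composable b n l i)
    (T : PBT l) : outerTree hfg (outerTree hh T) = outerTree hfh (outerTree hg T) := by
  have hT := T.numLeaves
  apply Subtype.ext
  simp only [outerTree]
  rw [deleteLeaves_comm _ (by omega) (by omega)]
  congr 1; omega

theorem innerTree_outerTree_par_left (hij : i < j) (hfg : Composable m n a i)
    (hh : Composable a p l (j + n - 1)) (hg : Composable b n l i)
    (T : PBT l) : innerTree hfg (outerTree hh T) = innerTree hg T := by
  have hT := T.numLeaves
  apply Subtype.ext
  simp only [outerTree, innerTree]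
  rw [deleteLeaves_deleteLeaves T.1 (by omega) (by omega) (by omega)]
  congr 2; omega

theorem innerTree_outerTree_par_right (hij : i < j)
    (hh : Composable a p l (j + n - 1)) (hfh : Composable m p b j) (hg : Composable b n l i)
    (T : PBT l) : innerTree hfh (outerTree hg T) = innerTree hh T := by
  have hT := T.numLeaves
  apply Subtype.ext
  simp only [outerTree, innerTree]
  have e := deleteLeaves_comm T.1 (i := i) (c := n - 1) (j := j + n - 1 + p) (e := m - j)
    (by omega) (by omega)
  rw [show j + n - 1 + p - (n - 1) = j + p by omega] at e
  rw [← e, deleteLeaves_deleteLeaves _ (i := 0) (j := i) (by omega) (by omega)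
      (by rw [numLeaves_deleteLeaves]; omega)]
  congr 1
  · congr 1; omega
  · omega

theorem outerTree_one (h : Composable m 1 m i) (T : PBT m) : outerTree h T = T := rfl

theorem innerTree_one (h : Composable 1 m m 1) (T : PBT m) : innerTree h T = T := rfl

end Trees

theorem isNSOperad_treeOperad {O : OperadData P} (hO : IsNSOperad k O) :
    IsNSOperad k (treeOperad k O) where
  add_comp h f f' g := TreeHom.ext_val fun T => by simp [hO.add_comp]
  smul_comp h c f g := TreeHom.ext_val fun T => by simp [hO.smul_comp]
  comp_add h f g g' := TreeHom.ext_val fun T => by simp [hO.comp_add]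
  comp_smul h c f g := TreeHom.ext_val fun T => by simp [hO.comp_smul]
  comp_seq hgh hf hfg hh f g h := TreeHom.ext_val fun T => by
    simp only [treeOperad_comp_val]
    rw [hO.comp_seq hgh hf hfg hh, outerTree_outerTree_seq hgh hf hfg hh,
      outerTree_innerTree_seq hgh hf hfg hh, innerTree_innerTree_seq hgh hf hh]
  comp_par hij hfg hh hfh hg f g h := TreeHom.ext_val fun T => by
    simp only [treeOperad_comp_val]
    rw [hO.comp_par hij hfg hh hfh hg, outerTree_outerTree_par hij hfg hh hfh hg,
      innerTree_outerTree_par_left hij hfg hh hg, innerTree_outerTree_par_right hij hh hfh hg]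
  comp_one h f := TreeHom.ext_val fun T => by
    rw [treeOperad_comp_val, outerTree_one]
    exact (congrArg _ (TreeHom.val_const _ _)).trans (hO.comp_one h _)
  one_comp h f := TreeHom.ext_val fun T => by
    rw [treeOperad_comp_val, innerTree_one]
    exact (congrArg (fun x => O.comp 1 h x _) (TreeHom.val_const _ _)).trans (hO.one_comp h _)

theorem isMultiplication_treeOperad_iff {O : OperadData P} {π : P 2} :
    IsMultiplication (treeOperad k O) (TreeHom.const k π) ↔ IsMultiplication O π := by
  constructor
  · intro h
    -- Any tree serves, since both sides are constant on trees; only nonemptiness of `Y_3` matters.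
    have T : PBT 3 := ⟨.node () .nil (.node () .nil (.node () .nil .nil)), rfl⟩
    simpa [IsMultiplication] using congrArg (fun F => TreeHom.val F T) h
  · intro h
    exact TreeHom.ext_val fun T => by simpa [IsMultiplication] using h

end TreeOperad

/-! ### Operads with a multiplication -/

section Circ

variable {P : ℕ → Type v} [∀ n, AddCommGroup (P n)]

/-- The partial composition at the input `i`, the inputs being numbered from `0`, extended by `0`
to all arities. -/
noncomputable def circ (O : OperadData P) {m n : ℕ} (l i : ℕ) (f : P m) (g : P n) : P l :=
  if h : Composable m n l (i + 1) then O.comp (i + 1) h f g else 0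

theorem comp_eq_circ (O : OperadData P) {m n l i : ℕ} (h : Composable m n l (i + 1)) (f : P m)
    (g : P n) : O.comp (i + 1) h f g = circ O l i f g := by
  rw [circ, dif_pos h]

/-- The contraction `∑ᵢ (-1)^{id} f ∘ᵢ g` by an element `g` of arity `d + 1`. -/
noncomputable def insertion (O : OperadData P) {m d : ℕ} (l : ℕ) (g : P (d + 1)) (f : P m) : P l :=
  ∑ i ∈ Finset.range m, (-1 : ℤ) ^ (i * d) • circ O l i f g

/-- The cup product, extended by `0` to all arities. -/
noncomputable def cupProd (O : OperadData P) (π : P 2) {m n : ℕ} (l : ℕ) (f : P m) (g : P n) :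
    P l :=
  circ O l 0 (circ O (n + 1) 1 π g) f

theorem contraction_eq_insertion (O : OperadData P) {m d l : ℕ} (hn : 1 ≤ d + 1)
    (h : m + (d + 1) = l + 1) (g : P (d + 1)) (f : P m) :
    contraction O hn h g f = insertion O l g f := by
  rw [contraction, insertion, Finset.sum_range]
  exact Finset.sum_congr rfl fun i _ => by rw [comp_eq_circ, Nat.add_sub_cancel]

theorem cup_eq_cupProd (O : OperadData P) (π : P 2) {m n l : ℕ} (hm : 1 ≤ m) (hn : 1 ≤ n)
    (h : m + n = l) (f : P m) (g : P n) : cup O π hm hn h f g = cupProd O π l f g := by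
  rw [cup, cupProd, comp_eq_circ O (i := 0), comp_eq_circ O (i := 1)]

variable {k : Type u} [Field k] [∀ n, Module k (P n)] {O : OperadData P}

/-! ### Multilinearity of compositions and insertions -/

section Linear

variable (hO : IsNSOperad k O) {m n : ℕ} (l i : ℕ)
include hO

theorem IsNSOperad.circ_add (f : P m) (g g' : P n) :
    circ O l i f (g + g') = circ O l i f g + circ O l i f g' := by
  unfold circ; split_ifs
  · exact hO.comp_add _ _ _ _
  · simp

theorem IsNSOperad.add_circ (f f' : P m) (g : P n) :
    circ O l i (f + f') g = circ O l i f g + circ O l i f' g := by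
  unfold circ; split_ifs
  · exact hO.add_comp _ _ _ _
  · simp

theorem IsNSOperad.circ_smul (c : k) (f : P m) (g : P n) :
    circ O l i f (c • g) = c • circ O l i f g := by
  unfold circ; split_ifs
  · exact hO.comp_smul _ _ _ _
  · simp

theorem IsNSOperad.smul_circ (c : k) (f : P m) (g : P n) :
    circ O l i (c • f) g = c • circ O l i f g := by
  unfold circ; split_ifs
  · exact hO.smul_comp _ _ _ _
  · simp

/-- `circ` as a biadditive map. -/
noncomputable def circHom : P m →+ P n →+ P l :=
  AddMonoidHom.mk' (fun f => AddMonoidHom.mk' (circ O l i f) (hO.circ_add l i f)) fun f f' => by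
    ext g; exact hO.add_circ l i f f' g

theorem IsNSOperad.circ_zsmul (c : ℤ) (f : P m) (g : P n) :
    circ O l i f (c • g) = c • circ O l i f g :=
  map_zsmul (circHom hO l i f) c g

theorem IsNSOperad.zsmul_circ (c : ℤ) (f : P m) (g : P n) :
    circ O l i (c • f) g = c • circ O l i f g :=
  DFunLike.congr_fun (map_zsmul (circHom hO l i) c f) g

theorem IsNSOperad.circ_neg (f : P m) (g : P n) : circ O l i f (-g) = -circ O l i f g :=
  map_neg (circHom hO l i f) g

theorem IsNSOperad.neg_circ (f : P m) (g : P n) : circ O l i (-f) g = -circ O l i f g :=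
  DFunLike.congr_fun (map_neg (circHom hO l i) f) g

theorem IsNSOperad.circ_sub (f : P m) (g g' : P n) :
    circ O l i f (g - g') = circ O l i f g - circ O l i f g' :=
  map_sub (circHom hO l i f) g g'

theorem IsNSOperad.sub_circ (f f' : P m) (g : P n) :
    circ O l i (f - f') g = circ O l i f g - circ O l i f' g :=
  DFunLike.congr_fun (map_sub (circHom hO l i) f f') g

theorem IsNSOperad.circ_zero (f : P m) : circ O l i f (0 : P n) = 0 :=
  map_zero (circHom hO l i f)

theorem IsNSOperad.zero_circ (g : P n) : circ O l i (0 : P m) g = 0 :=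
  DFunLike.congr_fun (map_zero (circHom hO l i)) g

theorem IsNSOperad.circ_sum {ι : Type*} (s : Finset ι) (f : P m) (g : ι → P n) :
    circ O l i f (∑ x ∈ s, g x) = ∑ x ∈ s, circ O l i f (g x) :=
  map_sum (circHom hO l i f) g s

theorem IsNSOperad.sum_circ {ι : Type*} (s : Finset ι) (f : ι → P m) (g : P n) :
    circ O l i (∑ x ∈ s, f x) g = ∑ x ∈ s, circ O l i (f x) g := by
  have := DFunLike.congr_fun (map_sum (circHom hO l i) f s) g
  rwa [AddMonoidHom.finsetSum_apply] at this

theorem IsNSOperad.insertion_add {d : ℕ} (g : P (d + 1)) (f f' : P m) :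
    insertion O l g (f + f') = insertion O l g f + insertion O l g f' := by
  simp only [insertion, hO.add_circ, smul_add, Finset.sum_add_distrib]

theorem IsNSOperad.add_insertion {d : ℕ} (g g' : P (d + 1)) (f : P m) :
    insertion O l (g + g') f = insertion O l g f + insertion O l g' f := by
  simp only [insertion, hO.circ_add, smul_add, Finset.sum_add_distrib]

theorem IsNSOperad.insertion_smul {d : ℕ} (c : k) (g : P (d + 1)) (f : P m) :
    insertion O l g (c • f) = c • insertion O l g f := by
  simp only [insertion, hO.smul_circ, Finset.smul_sum]
  exact Finset.sum_congr rfl fun i _ => smul_comm _ _ _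

theorem IsNSOperad.smul_insertion {d : ℕ} (c : k) (g : P (d + 1)) (f : P m) :
    insertion O l (c • g) f = c • insertion O l g f := by
  simp only [insertion, hO.circ_smul, Finset.smul_sum]
  exact Finset.sum_congr rfl fun i _ => smul_comm _ _ _

theorem IsNSOperad.insertion_sub {d : ℕ} (g : P (d + 1)) (f f' : P m) :
    insertion O l g (f - f') = insertion O l g f - insertion O l g f' := by
  simp only [insertion, hO.sub_circ, smul_sub, Finset.sum_sub_distrib]

theorem IsNSOperad.sub_insertion {d : ℕ} (g g' : P (d + 1)) (f : P m) :
    insertion O l (g - g') f = insertion O l g f - insertion O l g' f := by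
  simp only [insertion, hO.circ_sub, smul_sub, Finset.sum_sub_distrib]

theorem IsNSOperad.insertion_zsmul {d : ℕ} (c : ℤ) (g : P (d + 1)) (f : P m) :
    insertion O l g (c • f) = c • insertion O l g f := by
  simp only [insertion, hO.zsmul_circ, Finset.smul_sum]
  exact Finset.sum_congr rfl fun i _ => smul_comm _ _ _

theorem IsNSOperad.zsmul_insertion {d : ℕ} (c : ℤ) (g : P (d + 1)) (f : P m) :
    insertion O l (c • g) f = c • insertion O l g f := by
  simp only [insertion, hO.circ_zsmul, Finset.smul_sum]
  exact Finset.sum_congr rfl fun i _ => smul_comm _ _ _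

end Linear

/-! ### Associativity, the cup product and the calculus of insertions -/

section Laws

variable (hO : IsNSOperad k O)
include hO

theorem IsNSOperad.circ_seq {m n p a b l i j : ℕ} (hi : i < m) (hj : j < n) (hp : 1 ≤ p)
    (ha : n + p = a + 1) (hb : m + n = b + 1) (hl : m + a = l + 1)
    (f : P m) (g : P n) (h : P p) :
    circ O l i f (circ O a j g h) = circ O l (i + j) (circ O b i f g) h := by
  have := hO.comp_seq (i := i + 1) (j := j + 1) (l := l) (a := a) (b := b) (by omega) (by omega)
    (by omega) (by omega) f g h
  simpa only [comp_eq_circ, show i + 1 + (j + 1) - 1 = (i + j) + 1 by omega] using this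

theorem IsNSOperad.circ_par {m n p a b l i j j' : ℕ} (hij : i < j) (hj : j < m) (hn : 1 ≤ n)
    (hp : 1 ≤ p) (hj' : j' + 1 = j + n) (ha : m + n = a + 1) (hb : m + p = b + 1)
    (hl : a + p = l + 1) (f : P m) (g : P n) (h : P p) :
    circ O l j' (circ O a i f g) h = circ O l i (circ O b j f h) g := by
  have := hO.comp_par (i := i + 1) (j := j + 1) (l := l) (a := a) (b := b) (by omega) (by omega)
    (by omega) (by omega) (by omega) f g h
  simpa only [comp_eq_circ, show j + 1 + n - 1 = j' + 1 by omega] using this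

variable {π : P 2} (hπ : IsMultiplication O π)

omit [∀ n, Module k (P n)] hO in
theorem IsMultiplication.circ_eq (hπ : IsMultiplication O π) :
    circ O 3 0 π π = circ O 3 1 π π := by
  have := hπ
  rwa [IsMultiplication, comp_eq_circ O (i := 0), comp_eq_circ O (i := 1)] at this

include hπ

/-- Both sides are the threefold product with `g` in its last factor. -/
theorem IsMultiplication.circ_zero_self {n a l : ℕ} (hn : 1 ≤ n) (ha : n + 1 = a)
    (hl : n + 2 = l) (g : P n) :
    circ O l 0 (circ O a 1 π g) π = circ O l 1 π (circ O a 1 π g) := by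
  rw [hO.circ_seq (b := 3) (by omega) (by omega) hn (by omega) (by omega) (by omega), ← hπ.circ_eq]
  exact (hO.circ_par (by omega) (by omega) (by omega) (by omega) (by omega) (by omega) (by omega)
    (by omega) π π g).symm

/-- With x the free input, this is (x·f)·g = x·(f·g). -/
theorem IsMultiplication.circ_right_right {m n a b s l : ℕ} (hm : 1 ≤ m) (hn : 1 ≤ n)
    (ha : n + 1 = a) (hb : m + 1 = b) (hs : m + n = s) (hl : s + 1 = l) (f : P m) (g : P n) :
    circ O l 0 (circ O a 1 π g) (circ O b 1 π f) = circ O l 1 π (cupProd O π s f g) := by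
  subst ha
  rw [hO.circ_seq (b := n + 2) (by omega) (by omega) hm (by omega) (by omega) (by omega),
    hπ.circ_zero_self hO hn rfl rfl, cupProd,
    hO.circ_seq (b := n + 2) (by omega) (by omega) hm (by omega) (by omega) (by omega)]

/-- With x the free input, this is g·(f·x) = (g·f)·x. -/
theorem IsMultiplication.circ_left_left {m n a b s l : ℕ} (hm : 1 ≤ m) (hn : 1 ≤ n)
    (ha : n + 1 = a) (hb : m + 1 = b) (hs : m + n = s) (hl : s + 1 = l) (f : P m) (g : P n) :
    circ O l n (circ O a 0 π g) (circ O b 0 π f) = circ O l 0 π (cupProd O π s g f) := by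
  rw [hO.circ_par (i := 0) (j := 1) (b := m + 2) (by omega) (by omega) (by omega) (by omega)
    (by omega) (by omega) (by omega) (by omega),
    hO.circ_seq (b := 3) (i := 1) (j := 0) (by omega) (by omega) hm (by omega) (by omega)
      (by omega), ← hπ.circ_eq, cupProd,
    hO.circ_seq (b := m + 2) (i := 0) (j := 0) (by omega) (by omega) hn (by omega) (by omega)
      (by omega),
    hO.circ_seq (b := 3) (i := 0) (j := 1) (by omega) (by omega) hm (by omega) (by omega)
      (by omega)]

/-- With x the free input, this is (f·x)·g = f·(x·g). -/
theorem IsMultiplication.circ_right_left {m n a b l : ℕ} (hm : 1 ≤ m) (hn : 1 ≤ n)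
    (ha : n + 1 = a) (hb : m + 1 = b) (hl : m + n + 1 = l) (f : P m) (g : P n) :
    circ O l 0 (circ O a 1 π g) (circ O b 0 π f) =
      circ O l m (circ O b 0 π f) (circ O a 1 π g) := by
  rw [hO.circ_par (i := 0) (j := 1) (b := n + 2) (by omega) (by omega) (by omega) (by omega)
    (by omega) (by omega) (by omega) (by omega), ← hπ.circ_zero_self hO hn ha rfl,
    hO.circ_seq (b := n + 2) (i := 0) (j := 0) (by omega) (by omega) hm (by omega) (by omega)
      (by omega)]

theorem IsMultiplication.cupProd_assoc {m n p s t l : ℕ} (hm : 1 ≤ m) (hn : 1 ≤ n) (hp : 1 ≤ p)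
    (hs : m + n = s) (ht : n + p = t) (hl : m + t = l) (f : P m) (g : P n) (h : P p) :
    cupProd O π l (cupProd O π s f g) h = cupProd O π l f (cupProd O π t g h) := by
  rw [cupProd, cupProd, hO.circ_seq (b := t + 1) (i := 0) (j := 0) (by omega) (by omega) hm
    (by omega) (by omega) (by omega),
    hπ.circ_right_right hO hn hp rfl rfl ht rfl]
  rfl

omit hπ

/-- The contraction by `f` is a graded derivation of the cup product. -/
theorem IsNSOperad.insertion_cupProd {m n d s a b l : ℕ} (hm : 1 ≤ m) (hn : 1 ≤ n)
    (hs : m + n = s) (ha : m + d = a) (hb : n + d = b) (hl : s + d = l) (f : P (d + 1)) (x : P m)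
    (y : P n) :
    insertion O l f (cupProd O π s x y) =
      cupProd O π l (insertion O a f x) y +
        (-1 : ℤ) ^ (d * m) • cupProd O π l x (insertion O b f y) := by
  subst hs
  simp only [insertion, cupProd, hO.circ_sum, hO.sum_circ, hO.circ_zsmul, hO.zsmul_circ,
    Finset.smul_sum, smul_smul]
  -- The first m inputs of the cup product belong to `x`, the remaining n to `y`; the shift of the
  -- latter by m gives the sign (-1)^{dm}.
  rw [Finset.sum_range_add]
  congr 1
  · refine Finset.sum_congr rfl fun i hi => ?_
    rw [Finset.mem_range] at hi
    rw [hO.circ_seq (b := m + n) (by omega) hi (by omega) (by omega) (by omega) (by omega),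
      Nat.zero_add]
  · refine Finset.sum_congr rfl fun i hi => ?_
    rw [Finset.mem_range] at hi
    rw [hO.circ_par (i := 0) (j := i + 1) (b := b + 1) (by omega) (by omega) (by omega) (by omega)
      (by omega) (by omega) (by omega) (by omega),
      hO.circ_seq (b := n + 1) (i := 1) (j := i) (by omega) hi (by omega) (by omega) (by omega)
      (by omega), ← pow_add, add_comm 1 i]
    congr 2; ring

omit hO in
-- Once an element of arity n + 1 sits at input i of an element of arity p, the p + n inputs lie
-- before it, in it, or after it.
theorem sum_range_three_blocks {M : Type*} [AddCommMonoid M] {p n i : ℕ} (hi : i < p)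
    (φ : ℕ → M) :
    ∑ j ∈ Finset.range (p + n), φ j =
      ∑ j ∈ Finset.range i, φ j + ∑ j ∈ Finset.range (n + 1), φ (i + j) +
        ∑ j ∈ Finset.Ico (i + 1) p, φ (n + j) := by
  rw [show p + n = i + (n + 1) + (p - (i + 1)) by omega, Finset.sum_range_add,
    Finset.sum_range_add, Finset.sum_Ico_eq_sum_range]
  congr 1
  exact Finset.sum_congr rfl fun j _ => by congr 1; omega

/-- The part of `ι_f ι_g h` in which `f` and `g` are inserted side by side, `f` before `g`. -/
noncomputable def parallelInsertion (O : OperadData P) {m n p : ℕ} (l : ℕ) (f : P (m + 1))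
    (g : P (n + 1)) (h : P p) : P l :=
  ∑ i ∈ Finset.range p, ∑ j ∈ Finset.range i,
    (-1 : ℤ) ^ (i * n + j * m) • circ O l j (circ O (p + n) i h g) f

/-- After `g` is inserted into `h`, `f` lands inside `g`, before it or after it. By the parallel law
the last case is the second with `f` and `g` exchanged, up to (-1)^{mn}. -/
theorem IsNSOperad.insertion_insertion {m n p s t l : ℕ} (hs : p + n = s) (ht : n + m + 1 = t + 1)
    (hl : s + m = l) (f : P (m + 1)) (g : P (n + 1)) (h : P p) :
    insertion O l f (insertion O s g h) =
      insertion O l (insertion O (t + 1) f g) h + parallelInsertion O l f g h +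
        (-1 : ℤ) ^ (m * n) • parallelInsertion O l g f h := by
  subst hs
  have key : insertion O l f (insertion O (p + n) g h) =
      ∑ i ∈ Finset.range p, ∑ j ∈ Finset.range (p + n),
        (-1 : ℤ) ^ (i * n + j * m) • circ O l j (circ O (p + n) i h g) f := by
    simp only [insertion, hO.sum_circ, hO.zsmul_circ, Finset.smul_sum, smul_smul]
    rw [Finset.sum_comm]
    simp only [← pow_add, add_comm]
  rw [key, Finset.sum_congr rfl fun i hi => sum_range_three_blocks (Finset.mem_range.1 hi) _]
  simp only [Finset.sum_add_distrib]
  rw [parallelInsertion, parallelInsertion, add_comm (insertion O l _ _)]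
  congr 2
  · simp only [insertion, hO.circ_sum, hO.circ_zsmul, Finset.smul_sum, smul_smul]
    refine Finset.sum_congr rfl fun i hi => Finset.sum_congr rfl fun j hj => ?_
    rw [Finset.mem_range] at hi hj
    rw [hO.circ_seq (b := p + n) (i := i) (j := j) (by omega) (by omega) (by omega) (by omega)
      (by omega) (by omega), ← pow_add]
    congr 2
    obtain rfl : t = n + m := by omega
    ring
  · simp only [Finset.smul_sum, smul_smul]
    rw [Finset.sum_comm' (t' := Finset.range p) (s' := fun i => Finset.range i)
      (by intro x y; simp only [Finset.mem_range, Finset.mem_Ico]; omega)]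
    refine Finset.sum_congr rfl fun i hi => Finset.sum_congr rfl fun j hj => ?_
    rw [Finset.mem_range] at hi hj
    rw [hO.circ_par (i := j) (j := i) (b := p + m) (by omega) (by omega) (by omega) (by omega)
      (by omega) (by omega) (by omega) (by omega), ← pow_add]
    congr 2; ring

omit hO in
theorem neg_one_pow_smul_smul {M : Type*} [AddCommGroup M] (n : ℕ) (x : M) :
    (-1 : ℤ) ^ n • (-1 : ℤ) ^ n • x = x := by
  rw [smul_smul, ← mul_pow]; simp

/-- The contractions represent the Gerstenhaber bracket. -/
theorem IsNSOperad.insertion_commutator {m n p s s' t l : ℕ} (hs : p + n = s) (hs' : p + m = s')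
    (ht : n + m = t) (hl : s + m = l) (f : P (m + 1)) (g : P (n + 1)) (h : P p) :
    insertion O l (insertion O (t + 1) f g - (-1 : ℤ) ^ (m * n) • insertion O (t + 1) g f) h =
      insertion O l f (insertion O s g h) -
        (-1 : ℤ) ^ (m * n) • insertion O l g (insertion O s' f h) := by
  rw [hO.insertion_insertion hs (t := t) (by omega) hl,
    hO.insertion_insertion hs' (t := t) (by omega) (by omega), hO.sub_insertion,
    hO.zsmul_insertion, mul_comm n m]
  -- The two parallel parts together are graded symmetric in `f` and `g`, so they drop out.
  simp only [smul_add, neg_one_pow_smul_smul]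
  abel

end Laws

end Circ

/-! ### The map `θ` -/

section Theta

/-- The first and last leaves of `T` are kept, so the root survives, and the left branch loses
exactly the deleted leaves lying in it. -/
theorem leftLeaves_outerTree {m n l i x : ℕ} (hm : 2 ≤ m) (h : Composable m n l i) (T : PBT l)
    (hx : x + min (i + n - 1) (leftLeaves T.1) = leftLeaves T.1 + min i (leftLeaves T.1)) :
    leftLeaves (outerTree h T).1 = x := by
  have hT := T.numLeaves
  have hL := leftLeaves_bounds (t := T.1) (by omega)
  refine leftLeaves_deleteLeaves ?_ ?_ ?_ ?_
  · omega
  · rw [show i + (n - 1) = i + n - 1 by omega]; exact hx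
  · omega
  · omega

/-- The kept leaves run from i - 1 to i + n - 1. `h1` puts the first in the left branch and `h2` the
last in the right one, so the root survives and the left branch loses i - 1 leaves. -/
theorem leftLeaves_innerTree {m n l i x : ℕ} (h : Composable m n l i) (T : PBT l)
    (h1 : i ≤ leftLeaves T.1) (h2 : leftLeaves T.1 + 1 ≤ i + n) (hx : x + i = leftLeaves T.1 + 1) :
    leftLeaves (innerTree h T).1 = x := by
  have hT := T.numLeaves
  have e : leftLeaves (deleteLeaves T.1 (i + n) (m - i)) = leftLeaves T.1 :=
    leftLeaves_deleteLeaves (by omega) (by omega) (by omega) (by omega)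
  have e' := numLeaves_deleteLeaves T.1 (i + n) (m - i)
  exact leftLeaves_deleteLeaves (by omega) (by omega) (by omega) (by omega)

variable {k : Type u} [Field k] {P : ℕ → Type v} [∀ n, AddCommGroup (P n)] [∀ n, Module k (P n)]
  {O : OperadData P} {π : P 2}

/-- Allows θF to be replaced by whichever formula holds at the one tree where it is evaluated. -/
theorem circ_val_congr {m n l i : ℕ} (h : Composable m n l (i + 1)) {F F' : TreeHom k P m}
    {G G' : TreeHom k P n} {T : PBT l} (hF : F.val (outerTree h T) = F'.val (outerTree h T))
    (hG : G.val (innerTree h T) = G'.val (innerTree h T)) :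
    (circ (treeOperad k O) l i F G).val T = (circ (treeOperad k O) l i F' G').val T := by
  rw [← comp_eq_circ _ h, ← comp_eq_circ _ h, treeOperad_comp_val, treeOperad_comp_val, hF, hG]

/-- The outer trees in the definition of θ keep the leaves 0, 1, m + 1 and 0, m, m + 1 respectively;
they are `rightTree` and `leftTree` exactly when the left, respectively right, branch of `T` is a
single leaf. -/
theorem treeTheta_val {m : ℕ} (hm : 1 ≤ m) (F : TreeHom k P m) (T : PBT (m + 1)) :
    (treeTheta k O π hm F).val T =
      if leftLeaves T.1 = 1 then
        (-1 : ℤ) ^ m • (circ (treeOperad k O) (m + 1) 1 (TreeHom.const k π) F).val T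
      else if leftLeaves T.1 = m + 1 then
        -(circ (treeOperad k O) (m + 1) 0 (TreeHom.const k π) F).val T
      else 0 := by
  have hT := T.numLeaves
  have hL := leftLeaves_bounds (t := T.1) (by omega)
  have h2 := leftLeaves_outerTree (m := 2) (n := m) (i := 2) (x := min 2 (leftLeaves T.1)) le_rfl
    (by omega) T (by omega)
  have h1 := leftLeaves_outerTree (m := 2) (n := m) (i := 1)
    (x := leftLeaves T.1 + 1 - min m (leftLeaves T.1)) le_rfl (by omega) T (by omega)
  rw [treeTheta, TreeHom.val_mk, comp_eq_circ _ (i := 1), comp_eq_circ _ (i := 0)]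
  refine if_congr ?_ rfl (if_congr ?_ rfl rfl)
  · rw [PBT.eq_rightTree_iff, h2]; omega
  · rw [PBT.eq_leftTree_iff, h1]; omega

theorem treeTheta_val_of_eq_one {m : ℕ} (hm : 1 ≤ m) (F : TreeHom k P m) {T : PBT (m + 1)}
    (h : leftLeaves T.1 = 1) :
    (treeTheta k O π hm F).val T =
      ((-1 : ℤ) ^ m • circ (treeOperad k O) (m + 1) 1 (TreeHom.const k π) F).val T := by
  rw [treeTheta_val, if_pos h, TreeHom.val_zsmul]

theorem treeTheta_val_of_eq_top {m : ℕ} (hm : 1 ≤ m) (F : TreeHom k P m) {T : PBT (m + 1)}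
    (h : leftLeaves T.1 = m + 1) :
    (treeTheta k O π hm F).val T =
      (-circ (treeOperad k O) (m + 1) 0 (TreeHom.const k π) F).val T := by
  rw [treeTheta_val, if_neg (by omega), if_pos h, TreeHom.val_neg]

theorem treeTheta_val_of_ne {m : ℕ} (hm : 1 ≤ m) (F : TreeHom k P m) {T : PBT (m + 1)}
    (h : leftLeaves T.1 ≠ 1) (h' : leftLeaves T.1 ≠ m + 1) :
    (treeTheta k O π hm F).val T = (0 : TreeHom k P (m + 1)).val T := by
  rw [treeTheta_val, if_neg h, if_neg h', TreeHom.val_zero]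

variable (hO : IsNSOperad k O) {m n s : ℕ} (hm : 1 ≤ m) (hn : 1 ≤ n) (hs : m + n = s)
  (F : TreeHom k P m) (G : TreeHom k P n)
include hO

theorem treeTheta_add (F F' : TreeHom k P m) :
    treeTheta k O π hm (F + F') = treeTheta k O π hm F + treeTheta k O π hm F' := by
  have hQ := isNSOperad_treeOperad hO
  refine TreeHom.ext_val fun T => ?_
  simp only [TreeHom.val_add, treeTheta_val, hQ.circ_add]
  split_ifs <;> simp [add_comm]

theorem treeTheta_smul (c : k) (F : TreeHom k P m) :
    treeTheta k O π hm (c • F) = c • treeTheta k O π hm F := by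
  have hQ := isNSOperad_treeOperad hO
  refine TreeHom.ext_val fun T => ?_
  simp only [TreeHom.val_smul, treeTheta_val, hQ.circ_smul]
  split_ifs
  · exact smul_comm _ _ _
  · simp
  · simp

variable (hπ : IsMultiplication O π)

include hs hπ in
-- Every outer tree again has a one-leaf left branch, so θG acts as ±π ∘₂ G. Insertion at its first
-- input, the free input of `π`, yields the cup term; the other inputs are those of `G` and yield
-- the contraction.
theorem insertion_treeTheta_val_of_eq_one (T : PBT (s + 1)) (hT : leftLeaves T.1 = 1) :
    (insertion (treeOperad k O) (s + 1) (treeTheta k O π hm F) (treeTheta k O π hn G)).val T =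
      (-1 : ℤ) ^ s • (circ (treeOperad k O) (s + 1) 1 (TreeHom.const k π)
        (cupProd (treeOperad k O) (TreeHom.const k π) s F G +
          insertion (treeOperad k O) s (treeTheta k O π hm F) G)).val T := by
  have hQ := isNSOperad_treeOperad hO
  have hπQ := (isMultiplication_treeOperad_iff (k := k)).2 hπ
  have outer : ∀ i (h : Composable (n + 1) (m + 1) (s + 1) i),
      leftLeaves (outerTree h T).1 = 1 := fun i h =>
    leftLeaves_outerTree (by omega) h T (by omega)
  rw [insertion, TreeHom.val_sum, Finset.sum_range_succ', hQ.circ_add, TreeHom.val_add, smul_add]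
  refine (add_comm _ _).trans ?_
  congr 1
  · have h0 : Composable (n + 1) (m + 1) (s + 1) (0 + 1) := by omega
    rw [Nat.zero_mul, pow_zero, one_smul, circ_val_congr h0
      (treeTheta_val_of_eq_one hn G (outer _ h0))
      (treeTheta_val_of_eq_one hm F (leftLeaves_innerTree h0 T (by omega) (by omega) (by omega))),
      hQ.circ_zsmul, hQ.zsmul_circ, hπQ.circ_right_right hQ hm hn rfl rfl hs rfl, smul_smul,
      ← pow_add, hs, TreeHom.val_zsmul]
  · simp only [insertion, hQ.circ_sum, hQ.circ_zsmul, TreeHom.val_sum, Finset.smul_sum]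
    refine Finset.sum_congr rfl fun i hi => ?_
    rw [Finset.mem_range] at hi
    have h0 : Composable (n + 1) (m + 1) (s + 1) (i + 1 + 1) := by omega
    rw [TreeHom.val_zsmul, circ_val_congr h0 (treeTheta_val_of_eq_one hn G (outer _ h0)) rfl,
      hQ.circ_seq (b := n + 1) (by omega) hi (by omega) (by omega) (by omega) (by omega),
      hQ.zsmul_circ, TreeHom.val_zsmul, TreeHom.val_zsmul, smul_smul, smul_smul, ← pow_add,
      ← pow_add, add_comm 1 i]
    congr 2
    subst hs; ring

include hs hπ in
-- Mirror image of the previous case: θG acts as -π ∘₁ G, and the free input is now the last one.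
theorem insertion_treeTheta_val_of_eq_top (T : PBT (s + 1)) (hT : leftLeaves T.1 = s + 1) :
    (insertion (treeOperad k O) (s + 1) (treeTheta k O π hm F) (treeTheta k O π hn G)).val T =
      -(circ (treeOperad k O) (s + 1) 0 (TreeHom.const k π)
        (-((-1 : ℤ) ^ (m * n) • cupProd (treeOperad k O) (TreeHom.const k π) s G F) +
          insertion (treeOperad k O) s (treeTheta k O π hm F) G)).val T := by
  have hQ := isNSOperad_treeOperad hO
  have hπQ := (isMultiplication_treeOperad_iff (k := k)).2 hπ
  have outer : ∀ i (h : Composable (n + 1) (m + 1) (s + 1) i),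
      leftLeaves (outerTree h T).1 = n + 1 := fun i h =>
    leftLeaves_outerTree (by omega) h T (by omega)
  rw [insertion, TreeHom.val_sum, Finset.sum_range_succ, hQ.circ_add, TreeHom.val_add, neg_add]
  refine (add_comm _ _).trans ?_
  congr 1
  · have h0 : Composable (n + 1) (m + 1) (s + 1) (n + 1) := by omega
    rw [TreeHom.val_zsmul, circ_val_congr h0
      (treeTheta_val_of_eq_top hn G (outer _ h0))
      (treeTheta_val_of_eq_top hm F (leftLeaves_innerTree h0 T (by omega) (by omega) (by omega))),
      hQ.circ_neg, hQ.neg_circ, neg_neg, hπQ.circ_left_left hQ hm hn rfl rfl hs rfl,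
      hQ.circ_neg, hQ.circ_zsmul, TreeHom.val_neg, neg_neg, TreeHom.val_zsmul, mul_comm n m]
  · simp only [insertion, hQ.circ_sum, hQ.circ_zsmul, TreeHom.val_sum, ← Finset.sum_neg_distrib]
    refine Finset.sum_congr rfl fun i hi => ?_
    rw [Finset.mem_range] at hi
    have h0 : Composable (n + 1) (m + 1) (s + 1) (i + 1) := by omega
    rw [TreeHom.val_zsmul, circ_val_congr h0 (treeTheta_val_of_eq_top hn G (outer _ h0)) rfl,
      hQ.circ_seq (b := n + 1) (by omega) hi (by omega) (by omega) (by omega) (by omega),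
      hQ.neg_circ, TreeHom.val_neg, TreeHom.val_zsmul, smul_neg, Nat.zero_add]

include hs hπ in
-- Only insertions at the two extreme inputs of θG can be nonzero, and each needs one particular
-- size of the left branch. The right-hand side is arranged so that exchanging `F` and `G` swaps its
-- two summands up to (-1)^{mn}.
theorem insertion_treeTheta_val_of_ne (T : PBT (s + 1)) (h1 : leftLeaves T.1 ≠ 1)
    (hs1 : leftLeaves T.1 ≠ s + 1) :
    (insertion (treeOperad k O) (s + 1) (treeTheta k O π hm F) (treeTheta k O π hn G)).val T =
      (if leftLeaves T.1 = m + 1 then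
        -((-1 : ℤ) ^ n • (circ (treeOperad k O) (s + 1) 0
          (circ (treeOperad k O) (n + 1) 1 (TreeHom.const k π) G)
          (circ (treeOperad k O) (m + 1) 0 (TreeHom.const k π) F)).val T) else 0) +
      (if leftLeaves T.1 = n + 1 then
        -((-1 : ℤ) ^ (m * n) • (-1 : ℤ) ^ m • (circ (treeOperad k O) (s + 1) 0
          (circ (treeOperad k O) (m + 1) 1 (TreeHom.const k π) F)
          (circ (treeOperad k O) (n + 1) 0 (TreeHom.const k π) G)).val T) else 0) := by
  have hQ := isNSOperad_treeOperad hO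
  have hπQ := (isMultiplication_treeOperad_iff (k := k)).2 hπ
  have hTl := T.numLeaves
  have hL := leftLeaves_bounds (t := T.1) (by omega)
  have first : (circ (treeOperad k O) (s + 1) 0 (treeTheta k O π hn G)
      (treeTheta k O π hm F)).val T = if leftLeaves T.1 = m + 1 then
        -((-1 : ℤ) ^ n • (circ (treeOperad k O) (s + 1) 0
          (circ (treeOperad k O) (n + 1) 1 (TreeHom.const k π) G)
          (circ (treeOperad k O) (m + 1) 0 (TreeHom.const k π) F)).val T) else 0 := by
    have h0 : Composable (n + 1) (m + 1) (s + 1) (0 + 1) := by omega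
    split_ifs with hT
    · rw [circ_val_congr h0
        (treeTheta_val_of_eq_one hn G (leftLeaves_outerTree (by omega) h0 T (by omega)))
        (treeTheta_val_of_eq_top hm F (leftLeaves_innerTree h0 T (by omega) (by omega) (by omega))),
        hQ.circ_neg, hQ.zsmul_circ, TreeHom.val_neg, TreeHom.val_zsmul]
    · rcases le_or_gt (leftLeaves T.1) (m + 1) with h | h
      · have e := leftLeaves_innerTree (x := leftLeaves T.1) h0 T (by omega) (by omega) (by omega)
        rw [circ_val_congr h0 rfl (treeTheta_val_of_ne hm F (by omega) (by omega)),
          hQ.circ_zero, TreeHom.val_zero]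
      · have e := leftLeaves_outerTree (x := leftLeaves T.1 - m) (by omega) h0 T (by omega)
        rw [circ_val_congr h0 (treeTheta_val_of_ne hn G (by omega) (by omega)) rfl,
          hQ.zero_circ, TreeHom.val_zero]
  have last : (circ (treeOperad k O) (s + 1) n (treeTheta k O π hn G)
      (treeTheta k O π hm F)).val T = if leftLeaves T.1 = n + 1 then
        -((-1 : ℤ) ^ m • (circ (treeOperad k O) (s + 1) 0
          (circ (treeOperad k O) (m + 1) 1 (TreeHom.const k π) F)
          (circ (treeOperad k O) (n + 1) 0 (TreeHom.const k π) G)).val T) else 0 := by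
    have h0 : Composable (n + 1) (m + 1) (s + 1) (n + 1) := by omega
    split_ifs with hT
    · rw [circ_val_congr h0
        (treeTheta_val_of_eq_top hn G (leftLeaves_outerTree (by omega) h0 T (by omega)))
        (treeTheta_val_of_eq_one hm F (leftLeaves_innerTree h0 T (by omega) (by omega) (by omega))),
        hQ.circ_zsmul, hQ.neg_circ, TreeHom.val_zsmul, TreeHom.val_neg, smul_neg,
        hπQ.circ_right_left hQ hn hm rfl rfl (by omega)]
    · rcases le_or_gt (n + 1) (leftLeaves T.1) with h | h
      · have e := leftLeaves_innerTree (x := leftLeaves T.1 - n) h0 T (by omega) (by omega)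
          (by omega)
        rw [circ_val_congr h0 rfl (treeTheta_val_of_ne hm F (by omega) (by omega)),
          hQ.circ_zero, TreeHom.val_zero]
      · have e := leftLeaves_outerTree (x := leftLeaves T.1) (by omega) h0 T (by omega)
        rw [circ_val_congr h0 (treeTheta_val_of_ne hn G (by omega) (by omega)) rfl,
          hQ.zero_circ, TreeHom.val_zero]
  rw [insertion, TreeHom.val_sum, Finset.sum_range_succ, ← Finset.sum_erase_add _ _
    (Finset.mem_range.2 hn), Finset.sum_eq_zero, zero_add]
  · rw [TreeHom.val_zsmul, TreeHom.val_zsmul, first, last, Nat.zero_mul, pow_zero, one_smul,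
      smul_ite, smul_zero, smul_neg, mul_comm n m]
  · intro i hi
    rw [Finset.mem_erase, Finset.mem_range] at hi
    have h0 : Composable (n + 1) (m + 1) (s + 1) (i + 1) := by omega
    -- For 0 < i < n the leaves 0, 1 and s, s + 1 are all kept, so each branch of the outer tree has
    -- at least two leaves and θG vanishes there.
    have e := leftLeaves_outerTree (x := leftLeaves T.1 + min (i + 1) (leftLeaves T.1) -
      min (i + 1 + m) (leftLeaves T.1)) (by omega) h0 T (by omega)
    rw [TreeHom.val_zsmul, circ_val_congr h0 (treeTheta_val_of_ne hn G (by omega) (by omega)) rfl,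
      hQ.zero_circ, TreeHom.val_zero, smul_zero]

omit hO in
theorem treeDerivedBracket_eq (h : m + n = s) :
    treeDerivedBracket k O π hm hn h F G =
      cupProd (treeOperad k O) (TreeHom.const k π) s F G
        - (-1 : ℤ) ^ (m * n) • cupProd (treeOperad k O) (TreeHom.const k π) s G F
        + insertion (treeOperad k O) s (treeTheta k O π hm F) G
        - (-1 : ℤ) ^ (m * n) • insertion (treeOperad k O) s (treeTheta k O π hn G) F := by
  rw [treeDerivedBracket, cupBracket, cup_eq_cupProd, cup_eq_cupProd, contraction_eq_insertion,
    contraction_eq_insertion]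

include hπ in
/-- `θ` carries the derived bracket to the Gerstenhaber bracket. -/
theorem treeTheta_treeDerivedBracket (hs1 : 1 ≤ s) :
    treeTheta k O π hs1 (treeDerivedBracket k O π hm hn hs F G) =
      insertion (treeOperad k O) (s + 1) (treeTheta k O π hm F) (treeTheta k O π hn G) -
        (-1 : ℤ) ^ (m * n) •
          insertion (treeOperad k O) (s + 1) (treeTheta k O π hn G) (treeTheta k O π hm F) := by
  have hQ := isNSOperad_treeOperad hO
  have hs' : n + m = s := by omega
  refine TreeHom.ext_val fun T => ?_
  rw [TreeHom.val_sub, TreeHom.val_zsmul]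
  by_cases h1 : leftLeaves T.1 = 1
  · rw [treeTheta_val_of_eq_one _ _ h1, insertion_treeTheta_val_of_eq_one hO hm hn hs F G hπ T h1,
      insertion_treeTheta_val_of_eq_one hO hn hm hs' G F hπ T h1, treeDerivedBracket_eq]
    simp only [hQ.circ_add, hQ.circ_sub, hQ.circ_zsmul, TreeHom.val_zsmul, TreeHom.val_add,
      TreeHom.val_sub]
    module
  by_cases h2 : leftLeaves T.1 = s + 1
  · rw [treeTheta_val_of_eq_top _ _ h2, insertion_treeTheta_val_of_eq_top hO hm hn hs F G hπ T h2,
      insertion_treeTheta_val_of_eq_top hO hn hm hs' G F hπ T h2, treeDerivedBracket_eq]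
    simp only [hQ.circ_add, hQ.circ_sub, hQ.circ_neg, hQ.circ_zsmul, TreeHom.val_zsmul,
      TreeHom.val_add, TreeHom.val_sub, TreeHom.val_neg, mul_comm n m, smul_neg, neg_add, smul_add,
      neg_neg, neg_one_pow_smul_smul]
    module
  · rw [treeTheta_val_of_ne _ _ h1 h2, TreeHom.val_zero,
      insertion_treeTheta_val_of_ne hO hm hn hs F G hπ T h1 h2,
      insertion_treeTheta_val_of_ne hO hn hm hs' G F hπ T h1 h2]
    simp only [mul_comm n m, smul_add, smul_ite, smul_neg, smul_zero, neg_one_pow_smul_smul]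
    abel

end Theta

/-! ### The graded Lie algebra -/

section Lie

variable {k : Type u} [Field k] {P : ℕ → Type v} [∀ n, AddCommGroup (P n)] [∀ n, Module k (P n)]
  {O : OperadData P} {π : P 2}

section CupProd

variable (hO : IsNSOperad k O) {m n : ℕ} (l : ℕ)
include hO

theorem IsNSOperad.cupProd_add (f : P m) (g g' : P n) :
    cupProd O π l f (g + g') = cupProd O π l f g + cupProd O π l f g' := by
  simp only [cupProd, hO.circ_add, hO.add_circ]

theorem IsNSOperad.add_cupProd (f f' : P m) (g : P n) :
    cupProd O π l (f + f') g = cupProd O π l f g + cupProd O π l f' g := by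
  simp only [cupProd, hO.circ_add]

theorem IsNSOperad.cupProd_smul (c : k) (f : P m) (g : P n) :
    cupProd O π l f (c • g) = c • cupProd O π l f g := by
  simp only [cupProd, hO.circ_smul, hO.smul_circ]

theorem IsNSOperad.smul_cupProd (c : k) (f : P m) (g : P n) :
    cupProd O π l (c • f) g = c • cupProd O π l f g := by
  simp only [cupProd, hO.circ_smul]

theorem IsNSOperad.cupProd_sub (f : P m) (g g' : P n) :
    cupProd O π l f (g - g') = cupProd O π l f g - cupProd O π l f g' := by
  simp only [cupProd, hO.circ_sub, hO.sub_circ]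

theorem IsNSOperad.sub_cupProd (f f' : P m) (g : P n) :
    cupProd O π l (f - f') g = cupProd O π l f g - cupProd O π l f' g := by
  simp only [cupProd, hO.circ_sub]

theorem IsNSOperad.cupProd_zsmul (c : ℤ) (f : P m) (g : P n) :
    cupProd O π l f (c • g) = c • cupProd O π l f g := by
  simp only [cupProd, hO.circ_zsmul, hO.zsmul_circ]

theorem IsNSOperad.zsmul_cupProd (c : ℤ) (f : P m) (g : P n) :
    cupProd O π l (c • f) g = c • cupProd O π l f g := by
  simp only [cupProd, hO.circ_zsmul]

end CupProd

theorem treeDerivedBracket_skew {m n l : ℕ} (hm : 1 ≤ m) (hn : 1 ≤ n) (h : m + n = l)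
    (h' : n + m = l) (x : TreeHom k P m) (y : TreeHom k P n) :
    treeDerivedBracket k O π hm hn h x y =
      -((-1 : ℤ) ^ (m * n) • treeDerivedBracket k O π hn hm h' y x) := by
  rw [treeDerivedBracket_eq, treeDerivedBracket_eq, mul_comm n m]
  simp only [smul_add, smul_sub, neg_one_pow_smul_smul]
  abel

theorem treeDerivedBracket_jacobi (hO : IsNSOperad k O) (hπ : IsMultiplication O π)
    {m n p l : ℕ} (hm : 1 ≤ m) (hn : 1 ≤ n) (hp : 1 ≤ p) (h : m + n + p = l)
    (hmn : 1 ≤ m + n) (hmp : 1 ≤ m + p) (hnp : 1 ≤ n + p)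
    (h1 : m + (n + p) = l) (h2 : n + (m + p) = l)
    (x : TreeHom k P m) (y : TreeHom k P n) (z : TreeHom k P p) :
    treeDerivedBracket k O π hm hnp h1 x (treeDerivedBracket k O π hn hp rfl y z) =
      treeDerivedBracket k O π hmn hp h (treeDerivedBracket k O π hm hn rfl x y) z +
        (-1 : ℤ) ^ (m * n) •
          treeDerivedBracket k O π hn hmp h2 y (treeDerivedBracket k O π hm hp rfl x z) := by
  have hQ := isNSOperad_treeOperad hO
  have hπQ := (isMultiplication_treeOperad_iff (k := k)).2 hπ
  rw [treeDerivedBracket_eq hm hnp, treeDerivedBracket_eq hmn hp, treeDerivedBracket_eq hn hmp]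
  -- From here on only contractions by θx, θy and θz occur: θ of an inner bracket is a Gerstenhaber
  -- bracket, which then acts as a commutator of contractions.
  simp only [treeTheta_treeDerivedBracket hO _ _ _ _ _ hπ]
  rw [hQ.insertion_commutator (p := m) (s := m + p) (s' := m + n) rfl rfl (by omega) (by omega),
    hQ.insertion_commutator (p := p) (s := n + p) (s' := m + p) (by omega) (by omega) (by omega)
      (by omega),
    hQ.insertion_commutator (p := n) (s := n + p) (s' := m + n) (by omega) (by omega) (by omega)
      (by omega)]
  simp only [treeDerivedBracket_eq, hQ.cupProd_add, hQ.add_cupProd, hQ.cupProd_sub,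
    hQ.sub_cupProd, hQ.cupProd_zsmul, hQ.zsmul_cupProd, hQ.insertion_add, hQ.insertion_sub,
    hQ.insertion_zsmul]
  rw [hπQ.cupProd_assoc hQ hm hn hp rfl rfl h1, hπQ.cupProd_assoc hQ hn hm hp (by omega) rfl h2,
    hπQ.cupProd_assoc hQ hn hp hm rfl (t := m + p) (by omega) h2,
    hπQ.cupProd_assoc hQ hp hn hm (by omega) (t := m + n) (by omega) (by omega),
    hπQ.cupProd_assoc hQ hm hp hn rfl (t := n + p) (by omega) h1,
    hπQ.cupProd_assoc hQ hp hm hn (by omega) (t := m + n) rfl (by omega)]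
  rw [hQ.insertion_cupProd (a := m + n) (b := m + p) hn hp rfl (by omega) (by omega) (by omega)
      (treeTheta k O π hm x) y z,
    hQ.insertion_cupProd (a := m + p) (b := m + n) hp hn (by omega) (by omega) (by omega)
      (by omega) (treeTheta k O π hm x) z y,
    hQ.insertion_cupProd (a := m + n) (b := n + p) hm hp (by omega) (by omega) (by omega)
      (by omega) (treeTheta k O π hn y) x z,
    hQ.insertion_cupProd (a := n + p) (b := m + n) hp hm (by omega) (by omega) (by omega)
      (by omega) (treeTheta k O π hn y) z x,
    hQ.insertion_cupProd (a := m + p) (b := n + p) hm hn (by omega) (by omega) (by omega)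
      (by omega) (treeTheta k O π hp z) x y,
    hQ.insertion_cupProd (a := n + p) (b := m + p) hn hm (by omega) (by omega) (by omega)
      (by omega) (treeTheta k O π hp z) y x]
  simp only [mul_add, add_mul, pow_add, mul_comm n m, mul_comm p m, mul_comm p n]
  -- All signs are products of (-1)^{mn}, (-1)^{mp} and (-1)^{np}, so eight sign patterns remain,
  -- each a plain cancellation.
  rcases neg_one_pow_eq_or ℤ (m * n) with e1 | e1 <;>
  rcases neg_one_pow_eq_or ℤ (m * p) with e2 | e2 <;>
  rcases neg_one_pow_eq_or ℤ (n * p) with e3 | e3 <;>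
  (simp only [e1, e2, e3, mul_neg, mul_one, neg_neg, one_smul, neg_smul]; abel)

theorem isGradedLieBracket_treeDerivedBracket (hO : IsNSOperad k O) (hπ : IsMultiplication O π) :
    IsGradedLieBracket k (L := TreeHom k P) (treeDerivedBracket k O π) where
  add_left hm hn h x x' y := by
    have hQ := isNSOperad_treeOperad hO
    simp only [treeDerivedBracket_eq, treeTheta_add hO, hQ.add_cupProd, hQ.cupProd_add,
      hQ.add_insertion, hQ.insertion_add]
    module
  smul_left hm hn h c x y := by
    have hQ := isNSOperad_treeOperad hO
    simp only [treeDerivedBracket_eq, treeTheta_smul hO, hQ.smul_cupProd, hQ.cupProd_smul,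
      hQ.smul_insertion, hQ.insertion_smul, smul_add, smul_sub]
    simp only [smul_comm _ c]
  add_right hm hn h x y y' := by
    have hQ := isNSOperad_treeOperad hO
    simp only [treeDerivedBracket_eq, treeTheta_add hO, hQ.add_cupProd, hQ.cupProd_add,
      hQ.add_insertion, hQ.insertion_add]
    module
  smul_right hm hn h c x y := by
    have hQ := isNSOperad_treeOperad hO
    simp only [treeDerivedBracket_eq, treeTheta_smul hO, hQ.smul_cupProd, hQ.cupProd_smul,
      hQ.smul_insertion, hQ.insertion_smul, smul_add, smul_sub]
    simp only [smul_comm _ c]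
  skew hm hn h x y := treeDerivedBracket_skew hm hn h _ x y
  jacobi hm hn hp h x y z := treeDerivedBracket_jacobi hO hπ hm hn hp h _ _ _ _ _ x y z

/-! ### Maurer–Cartan elements -/

theorem TreeHom.eq_const (R : TreeHom k P 1) :
    R = TreeHom.const k (R.val ⟨.node () .nil .nil, rfl⟩) :=
  TreeHom.ext_val fun T => by rw [TreeHom.val_const, PBT.eq_of_one T]

/-- For constant maps only θ sees the tree: it gives -π ∘₂ r or -π ∘₁ r. The factor 2 appears
because (-1)^{1·1} = -1 makes the bracket symmetric in degree 1. -/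
theorem treeDerivedBracket_const_val (hO : IsNSOperad k O) (r : P 1) (T : PBT 2) :
    (treeDerivedBracket k O π (l := 2) le_rfl le_rfl rfl (TreeHom.const k r)
      (TreeHom.const k r)).val T =
      (2 : k) • (cupProd O π 2 r r -
        circ O 2 0 r (circ O 2 (if leftLeaves T.1 = 1 then 1 else 0) π r)) := by
  have hQ := isNSOperad_treeOperad hO
  have hT := T.numLeaves
  have hL := leftLeaves_bounds (t := T.1) (by omega)
  have circ_const : ∀ {m n l i : ℕ} (h : Composable m n l (i + 1)) (f : P m) (g : P n),
      circ (treeOperad k O) l i (TreeHom.const k f) (TreeHom.const k g) =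
        TreeHom.const k (circ O l i f g) := fun h f g => TreeHom.ext_val fun T => by
    rw [← comp_eq_circ _ h, treeOperad_comp_val, ← comp_eq_circ _ h]; simp
  have cup_const : cupProd (treeOperad k O) (TreeHom.const k π) 2 (TreeHom.const k r)
      (TreeHom.const k r) = TreeHom.const k (cupProd O π 2 r r) := by
    rw [cupProd, circ_const (by omega), circ_const (by omega)]; rfl
  have theta : ∀ S : PBT 2, (treeTheta k O π le_rfl (TreeHom.const k r)).val S =
      -circ O 2 (if leftLeaves S.1 = 1 then 1 else 0) π r := fun S => by
    have hS := S.numLeaves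
    have hL := leftLeaves_bounds (t := S.1) (by omega)
    rw [treeTheta_val, circ_const (by omega), circ_const (by omega)]
    split_ifs
    · simp
    · simp
    -- The left branch of a tree in `Y_2` has one or two leaves, so the zero case of θ cannot occur.
    · omega
  have ins : (insertion (treeOperad k O) 2 (treeTheta k O π le_rfl (TreeHom.const k r))
      (TreeHom.const k r)).val T =
      -circ O 2 0 r (circ O 2 (if leftLeaves T.1 = 1 then 1 else 0) π r) := by
    have h0 : Composable 1 2 2 (0 + 1) := by omega
    rw [insertion, Finset.sum_range_one, zero_mul, pow_zero, one_smul, ← comp_eq_circ _ h0,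
      treeOperad_comp_val, theta, innerTree_one, TreeHom.val_const, comp_eq_circ, hO.circ_neg]
  rw [treeDerivedBracket_eq, cup_const]
  simp only [TreeHom.val_add, TreeHom.val_sub, TreeHom.val_zsmul, TreeHom.val_const, ins]
  module

theorem isMaurerCartan_const_iff [CharZero k] (hO : IsNSOperad k O) (r : P 1) :
    IsMaurerCartan (L := TreeHom k P) (treeDerivedBracket k O π) (TreeHom.const k r) ↔
      IsAveragingElement O π r := by
  have avg : IsAveragingElement O π r ↔
      cupProd O π 2 r r = circ O 2 0 r (circ O 2 0 π r) ∧
        cupProd O π 2 r r = circ O 2 0 r (circ O 2 1 π r) := by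
    rw [IsAveragingElement, comp_eq_circ O (i := 0), comp_eq_circ O (i := 1),
      comp_eq_circ O (i := 0), comp_eq_circ O (i := 0), comp_eq_circ O (i := 0)]
    constructor
    · rintro ⟨h, h'⟩; exact ⟨h, h.trans h'⟩
    · rintro ⟨h, h'⟩; exact ⟨h, h.symm.trans h'⟩
  rw [avg, IsMaurerCartan]
  constructor
  · intro h
    have key : ∀ T : PBT 2, cupProd O π 2 r r =
        circ O 2 0 r (circ O 2 (if leftLeaves T.1 = 1 then 1 else 0) π r) := fun T => by
      have := congrArg (fun F => TreeHom.val F T) h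
      rw [treeDerivedBracket_const_val hO, TreeHom.val_zero, smul_eq_zero, sub_eq_zero] at this
      -- Characteristic 0 is used here to cancel the factor 2.
      exact this.resolve_left two_ne_zero
    exact ⟨key leftTree, key rightTree⟩
  · rintro ⟨h0, h1⟩
    refine TreeHom.ext_val fun T => ?_
    rw [treeDerivedBracket_const_val hO]
    split_ifs
    · rw [h1, sub_self, smul_zero, TreeHom.val_zero]
    · rw [h0, sub_self, smul_zero, TreeHom.val_zero]

end Lie

end AveragingOperad

open AveragingOperad in
theorem mainTheorem11 {k : Type*} [Field k] [CharZero k] {P : ℕ → Type*}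
    [∀ n, AddCommGroup (P n)] [∀ n, Module k (P n)] (O : OperadData P) (hO : IsNSOperad k O)
    (π : P 2) :
    IsNSOperad k (treeOperad k O) ∧
    (IsMultiplication O π ↔ IsMultiplication (treeOperad k O) (TreeHom.const k π)) ∧
    (IsMultiplication O π →
      IsGradedLieBracket k (L := TreeHom k P) (treeDerivedBracket k O π) ∧
      (∀ r : P 1, IsAveragingElement O π r ↔
        IsMaurerCartan (L := TreeHom k P) (treeDerivedBracket k O π) (TreeHom.const k r)) ∧
      (∀ R : TreeHom k P 1, IsMaurerCartan (L := TreeHom k P) (treeDerivedBracket k O π) R ↔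
        ∃ r : P 1, IsAveragingElement O π r ∧ R = TreeHom.const k r)) := by
  refine ⟨isNSOperad_treeOperad hO, isMultiplication_treeOperad_iff.symm, fun hπ =>
    ⟨isGradedLieBracket_treeDerivedBracket hO hπ, fun r => (isMaurerCartan_const_iff hO r).symm,
      fun R => ⟨fun h => ?_, ?_⟩⟩⟩
  · have e := R.eq_const
    rw [e] at h
    exact ⟨_, (isMaurerCartan_const_iff hO _).1 h, e⟩
  · rintro ⟨r, hr, rfl⟩
    exact (isMaurerCartan_const_iff hO r).2 hr
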